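/- Let $\mathbb{T}^d=\mathbb{R}^d/\mathbb{Z}^d$, $I=[0,1]$, and let $F:\mathbb{T}^d\times I\to\mathbb{T}^d\times I$, $F(b,x)=(Ab,f_b(x))$, be a skew product, where $A\in GL(d,\mathbb{Z})$ is a hyperbolic automorphism of the torus (no eigenvalue of modulus one) and each $f_b$ is an orientation preserving $C^k$ diffeomorphism of $I$ with $f_b(0)=0$, $f_b(1)=1$, where $k\ge 2$. Suppose that there are $C_k,\beta>0$ with $\|f_b-f_{b'}\|_{C^k}\le C_k\|b-b'\|^{\beta}$ for all $b,b'\in\mathbb{T}^d$. Put $\lambda_b=f_b'(0)>0$, and let $O=(b_0,0)$ be a hyperbolic fixed point of $F$, i.e. $Ab_0=b_0$ and $\lambda_{b_0}\neq 1$. If $\lambda_{b_0}<1$, let $\mu$ be the largest magnitude of the eigenvalues of $A$ and let $q$ be any number with $\lambda_{b_0}<q<1$; if $\lambda_{b_0}>1$, let $\mu$ be the largest magnitude of the eigenvalues of $A^{-1}$ and let $q$ be any number with $\lambda_{b_0}^{-1}<q<1$. Then there exist a neighborhood $U=V\times[0,\varepsilon]$ of $O$ in $\mathbb{T}^d\times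 I$, with $V\ni b_0$ open, and a fiber preserving homeomorphism $H$ of $U$ onto a neighborhood of $O$ in $\mathbb{T}^d\times I$, of the form $$H(b,x)=(b,x+h_b(x)),\qquad h_b(0)=\frac{\partial h_b}{\partial x}(0)=0\quad(b\in V),$$ such that: 1. $H$ conjugates $F$ with its fiberwise linearization $F_0(b,x)=(Ab,\lambda_b x)$ near $O$: $F(H(b,x))=H(F_0(b,x))$ whenever $(b,x)\in U$ and $F_0(b,x)\in U$; 2. for every $b\in V$ the function $h_b$ is of class $C^{k-2}$ on $[0,\varepsilon]$; 3. for every $\alpha$ with $0<\alpha<\min(\beta,\log_\mu(1/q))$ and every integer $l$ with $0\le l\le k-2$ there is a constant $\tilde C_l>0$ such that $\|h_b-h_{b'}\|_{C^l[0,\varepsilon]}\le\tilde C_l\|b-b'\|^{\alpha}$ for all $b,b'\in V$. -/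

import Mathlib

open Set Topology
open scoped ENNReal

noncomputable section

/-- The torus `ℝ^d / ℤ^d`, with the maximum of the circle distances as metric
(it is Lipschitz equivalent to the flat Euclidean one). -/
abbrev Torus (d : ℕ) : Type := Fin d → UnitAddCircle

/-- The linear automorphism of the torus induced by `A ∈ GL(d, ℤ)`. -/
def torusAut {d : ℕ} (A : Matrix.GeneralLinearGroup (Fin d) ℤ) (b : Torus d) : Torus d :=
  fun i => ∑ j, A.val i j • b j

/-- The integer matrix `A` regarded as a complex matrix. -/
def complexMatrix {d : ℕ} (A : Matrix.GeneralLinearGroup (Fin d) ℤ) :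
    Matrix (Fin d) (Fin d) ℂ :=
  A.val.map (fun n : ℤ => (n : ℂ))

/-- Hyperbolicity of the automorphism: no eigenvalue has modulus one. -/
def IsHyperbolicAut {d : ℕ} (A : Matrix.GeneralLinearGroup (Fin d) ℤ) : Prop :=
  ∀ z ∈ spectrum ℂ (complexMatrix A), ‖z‖ ≠ 1

/-- The largest magnitude of the eigenvalues of `A`. -/
def maxEigenvalueNorm {d : ℕ} (A : Matrix.GeneralLinearGroup (Fin d) ℤ) : ℝ :=
  (spectralRadius ℂ (complexMatrix A)).toReal

/-- The fiber `I = [0, 1]`. -/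
abbrev fiberI : Set ℝ := Icc 0 1

/-- The phase space `𝕋^d × [0, 1]`, as a subset of `𝕋^d × ℝ`. -/
abbrev phaseSpace (d : ℕ) : Set (Torus d × ℝ) := univ ×ˢ fiberI

/-- The `C^l` norm of `g` on `J`: the largest of the sup norms of the derivatives (taken within `J`)
of order at most `l`. -/
def cNorm (l : ℕ) (J : Set ℝ) (g : ℝ → ℝ) : ℝ≥0∞ :=
  ⨆ (j : ℕ) (_ : j ≤ l) (x : ℝ) (_ : x ∈ J), ‖iteratedDerivWithin j g J x‖ₑ

/-- `g` restricts to an orientation preserving `C^k` diffeomorphism of `[0, 1]` onto itself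
(the values of `g` outside `[0, 1]` play no role). -/
structure IsFiberDiffeo (k : ℕ) (g : ℝ → ℝ) : Prop where
  contDiffOn : ContDiffOn ℝ k g fiberI
  map_zero : g 0 = 0
  map_one : g 1 = 1
  bijOn : BijOn g fiberI fiberI
  deriv_pos : ∀ x ∈ fiberI, 0 < derivWithin g fiberI x

/-- The skew product `F(b, x) = (A b, f_b(x))`. -/
def skewMap {d : ℕ} (A : Matrix.GeneralLinearGroup (Fin d) ℤ) (f : Torus d → ℝ → ℝ)
    (p : Torus d × ℝ) : Torus d × ℝ :=
  (torusAut A p.1, f p.1 p.2)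

/-- The fiber multiplier `λ_b = f_b'(0)` (a one-sided derivative). -/
def fiberMultiplier {d : ℕ} (f : Torus d → ℝ → ℝ) (b : Torus d) : ℝ :=
  derivWithin (f b) fiberI 0

/-- The fiberwise linearization `F₀(b, x) = (A b, λ_b x)`. -/
def linearizedMap {d : ℕ} (A : Matrix.GeneralLinearGroup (Fin d) ℤ) (f : Torus d → ℝ → ℝ)
    (p : Torus d × ℝ) : Torus d × ℝ :=
  (torusAut A p.1, fiberMultiplier f p.1 * p.2)

/-- The fiber preserving map `H(b, x) = (b, x + h_b(x))`. -/
def fiberShift {d : ℕ} (h : Torus d → ℝ → ℝ) (p : Torus d × ℝ) : Torus d × ℝ :=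
  (p.1, p.2 + h p.1 p.2)

/-- `(b₀, 0)` is a hyperbolic fixed point of the skew product: it is fixed, and none of its
multipliers (the eigenvalues of `A` in the base, `λ_{b₀}` in the fiber) has modulus one. -/
def IsHyperbolicFixedPoint {d : ℕ} (A : Matrix.GeneralLinearGroup (Fin d) ℤ)
    (f : Torus d → ℝ → ℝ) (b₀ : Torus d) : Prop :=
  skewMap A f (b₀, 0) = (b₀, 0) ∧ IsHyperbolicAut A ∧ |fiberMultiplier f b₀| ≠ 1

/-- The contraction rate in the fiber at `(b₀, 0)`: `λ_{b₀}` if `F` contracts there, and `1 / λ_{b₀}`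
(the multiplier of `F⁻¹`) if `F` expands there. -/
def contractionRate {d : ℕ} (f : Torus d → ℝ → ℝ) (b₀ : Torus d) : ℝ :=
  min (fiberMultiplier f b₀) (fiberMultiplier f b₀)⁻¹

open Classical in
/-- The largest magnitude of the eigenvalues of the base map of that one of `F`, `F⁻¹` which contracts
in the fiber direction at `(b₀, 0)`: of `A` if `λ_{b₀} < 1`, of `A⁻¹` otherwise. -/
def baseExpansion {d : ℕ} (A : Matrix.GeneralLinearGroup (Fin d) ℤ) (f : Torus d → ℝ → ℝ)
    (b₀ : Torus d) : ℝ :=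
  if fiberMultiplier f b₀ < 1 then maxEigenvalueNorm A else maxEigenvalueNorm A⁻¹

end

/-!
The linearization is obtained from a cohomological equation along the fibers. Near `x = 0` a fiber
map of class `C^k` can be written `f_b(x) = λ_b x exp(r_b(x))` with `r_b(0) = 0` and `r_b` of
class `C^{k-2}` with Lipschitz derivatives; the integral formula `f_b(x) = x ∫₀¹ f_b'(t x) dt`
gives this with uniform bounds (`exists_fiberData`). Looking for the inverse of the conjugacy in
the form `G_b(x) = x exp(w_b(x))`, the relation `G_{Ab} ∘ f_b = λ_b G_b` becomes the *linear*
equation `w_b = r_b + w_{Ab} ∘ f_b`. If the fiber maps contract, its solution is the series of the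
`r` along the orbit, and `H = G⁻¹` is the conjugacy (`exists_linearization`). If the fibers
expand, the same is done for the inverse skew product, whose fiber maps are again of this form
(`exists_inverse_fiberData`).

Regularity of `w` is proved without iterating: each fiber derivative of `w` solves an equation
`W = R + m · W ∘ F`, where `R`, `m` are built from lower derivatives and from the data, and where `m`
carries a factor `f'`, hence is at most `q` (`SmoothFamily.solution`). For such an equation a
quantity like `|W_b(x) - W_{b'}(x)|` is bounded by the error made in one step plus `q` times the
same quantity at the image points. If one step of the base map expands `‖b - b'‖ ^ α` by at most
`κ` with `q κ < 1`, this recursive inequality closes up (`le_of_recursive_bound`), and `W` depends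
on `b` in an `α`-Hölder way; this is the role of the condition `α < log_μ (1 / q)`. For `w` itself
there is no factor `f'`, but all differences are `O(x)` times the gauge, and `x` decreases by the
factor `q` instead (`WeightedFamily`).

Since the conjugacy is only asked for near `b₀`, the base is replaced by the universal cover `ℝ^d`
with the linear map `A`, and the family is extended there by means of a Lipschitz retraction of
`ℝ^d` onto a small ball (`exists_lifted_data`). Gelfand's formula provides a norm on `ℝ^d` that is
expanded in one step by a factor arbitrarily close to the largest magnitude of the eigenvalues
(`exists_adapted_gauge`).
-/

/-! ### Families of fiber functions with Lipschitz derivatives -/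

/-- A family `g b : [0, a] → ℝ` that is uniformly bounded, uniformly Lipschitz in the fiber variable
and Lipschitz in the parameter `b` with respect to the gauge `σ`. No triangle inequality is asked of
`σ`, so that `σ = dist ^ α` is allowed for every `α > 0`. -/
def LipFamily {B : Type*} (σ : B → B → ℝ) (a : ℝ) (g : B → ℝ → ℝ) : Prop :=
  ∃ M : ℝ, 0 ≤ M ∧ (∀ b, ∀ x ∈ Icc 0 a, |g b x| ≤ M) ∧
    (∀ b, ∀ x ∈ Icc 0 a, ∀ y ∈ Icc 0 a, |g b x - g b y| ≤ M * |x - y|) ∧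
    (∀ b b', ∀ x ∈ Icc 0 a, |g b x - g b' x| ≤ M * σ b b')

/-- A family `g b : [0, a] → ℝ` whose fiber derivatives of order at most `l` exist (one-sided at the
end points) and are `LipFamily`s. -/
def SmoothFamily {B : Type*} (σ : B → B → ℝ) (a : ℝ) : ℕ → (B → ℝ → ℝ) → Prop
  | 0, g => LipFamily σ a g
  | l + 1, g => LipFamily σ a g ∧ ∃ g' : B → ℝ → ℝ,
      (∀ b, ∀ x ∈ Icc 0 a, HasDerivWithinAt (g b) (g' b x) (Icc 0 a) x) ∧ SmoothFamily σ a l g'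

/-- A family that is uniformly Lipschitz in the fiber variable, and whose dependence on the parameter
degenerates linearly at `x = 0`. -/
def WeightedFamily {B : Type*} (σ : B → B → ℝ) (a : ℝ) (g : B → ℝ → ℝ) : Prop :=
  ∃ M : ℝ, 0 ≤ M ∧
    (∀ b, ∀ x ∈ Icc 0 a, ∀ y ∈ Icc 0 a, |g b x - g b y| ≤ M * |x - y|) ∧
    (∀ b b', ∀ x ∈ Icc 0 a, |g b x - g b' x| ≤ M * (x * σ b b'))

theorem hasDerivWithinAt_of_quadratic_bound {g : ℝ → ℝ} {s : Set ℝ} {x d M : ℝ}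
    (h : ∀ y ∈ s, |g y - g x - d * (y - x)| ≤ M * |y - x| ^ 2) : HasDerivWithinAt g d s x := by
  rw [hasDerivWithinAt_iff_isLittleO]
  have h1 : (fun y => g y - g x - (y - x) • d) =O[𝓝[s] x] (fun y => |y - x| ^ 2) := by
    refine Asymptotics.IsBigO.of_bound M ?_
    filter_upwards [self_mem_nhdsWithin] with y hy
    have := h y hy
    simpa [mul_comm] using this
  refine h1.trans_isLittleO ?_
  have h2 : Filter.Tendsto (fun y : ℝ => y - x) (𝓝[s] x) (𝓝 0) := by
    have : Filter.Tendsto (fun y : ℝ => y - x) (𝓝 x) (𝓝 (x - x)) := by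
      exact (continuous_id.sub continuous_const).tendsto x
    rw [sub_self] at this
    exact this.mono_left nhdsWithin_le_nhds
  have h3 : (fun y : ℝ => y - x) =o[𝓝[s] x] (fun _ => (1 : ℝ)) :=
    (Asymptotics.isLittleO_one_iff ℝ).2 h2
  have := h3.mul_isBigO (Asymptotics.isBigO_refl (fun y : ℝ => y - x) (𝓝[s] x))
  simpa [sq] using this

theorem nhdsWithin_Icc_diff_neBot {a x : ℝ} (ha : 0 < a) (hx : x ∈ Icc 0 a) :
    (𝓝[Icc 0 a \ {x}] x).NeBot := by
  have := uniqueDiffOn_Icc ha x hx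
  rwa [uniqueDiffWithinAt_iff_accPt, accPt_principal_iff_nhdsWithin] at this

theorem abs_deriv_le_of_lipschitz {g : ℝ → ℝ} {a x d M : ℝ} (ha : 0 < a) (hx : x ∈ Icc 0 a)
    (hg : HasDerivWithinAt g d (Icc 0 a) x) (h : ∀ y ∈ Icc 0 a, |g y - g x| ≤ M * |y - x|) :
    |d| ≤ M := by
  have := nhdsWithin_Icc_diff_neBot ha hx
  refine le_of_tendsto (hasDerivWithinAt_iff_tendsto_slope.1 hg).abs ?_
  filter_upwards [self_mem_nhdsWithin] with y hy
  have hpos : 0 < |y - x| := abs_pos.2 (sub_ne_zero.2 hy.2)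
  rw [slope_def_field, abs_div, div_le_iff₀ hpos]
  exact h y hy.1

theorem le_abs_deriv_of_expanding {g : ℝ → ℝ} {a x d c : ℝ} (ha : 0 < a) (hx : x ∈ Icc 0 a)
    (hg : HasDerivWithinAt g d (Icc 0 a) x) (h : ∀ y ∈ Icc 0 a, c * |y - x| ≤ |g y - g x|) :
    c ≤ |d| := by
  have := nhdsWithin_Icc_diff_neBot ha hx
  refine ge_of_tendsto (hasDerivWithinAt_iff_tendsto_slope.1 hg).abs ?_
  filter_upwards [self_mem_nhdsWithin] with y hy
  have hpos : 0 < |y - x| := abs_pos.2 (sub_ne_zero.2 hy.2)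
  rw [slope_def_field, abs_div, le_div_iff₀ hpos]
  exact h y hy.1

theorem abs_sub_le_of_hasDerivWithinAt {g g' : ℝ → ℝ} {a M : ℝ}
    (hg : ∀ x ∈ Icc 0 a, HasDerivWithinAt g (g' x) (Icc 0 a) x) (hM : ∀ x ∈ Icc 0 a, |g' x| ≤ M)
    {x y : ℝ} (hx : x ∈ Icc 0 a) (hy : y ∈ Icc 0 a) : |g y - g x| ≤ M * |y - x| :=
  Convex.norm_image_sub_le_of_norm_hasDerivWithin_le (C := M) hg hM (convex_Icc 0 a) hx hy

/-- Taylor's formula of order one for a function with Lipschitz derivative. -/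
theorem abs_taylor_one_le {g g' : ℝ → ℝ} {a M : ℝ} (hM0 : 0 ≤ M)
    (hg : ∀ x ∈ Icc 0 a, HasDerivWithinAt g (g' x) (Icc 0 a) x)
    (hM : ∀ x ∈ Icc 0 a, ∀ y ∈ Icc 0 a, |g' x - g' y| ≤ M * |x - y|)
    {x y : ℝ} (hx : x ∈ Icc 0 a) (hy : y ∈ Icc 0 a) :
    |g y - g x - g' x * (y - x)| ≤ M * |y - x| ^ 2 := by
  have hsub : uIcc x y ⊆ Icc 0 a := uIcc_subset_Icc hx hy
  have hd : ∀ z ∈ uIcc x y, HasDerivWithinAt (fun z => g z - g' x * z) (g' z - g' x) (uIcc x y) z := by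
    intro z hz
    have h1 := (hg z (hsub hz)).mono hsub
    have h2 := ((hasDerivWithinAt_id z (uIcc x y)).const_mul (g' x))
    have h3 := h1.sub h2
    rw [mul_one] at h3
    exact h3
  have hb : ∀ z ∈ uIcc x y, ‖g' z - g' x‖ ≤ M * |y - x| := by
    intro z hz
    refine (hM z (hsub hz) x hx).trans ?_
    gcongr 1
    exact abs_sub_left_of_mem_uIcc hz
  have := Convex.norm_image_sub_le_of_norm_hasDerivWithin_le hd hb (convex_uIcc x y)
    left_mem_uIcc right_mem_uIcc
  rw [Real.norm_eq_abs, Real.norm_eq_abs] at this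
  calc _ = |g y - g' x * y - (g x - g' x * x)| := by congr 1; ring
    _ ≤ _ := this
    _ = _ := by ring

theorem abs_exp_sub_exp_le {M s t : ℝ} (hs : s ≤ M) (ht : t ≤ M) :
    |Real.exp s - Real.exp t| ≤ Real.exp M * |s - t| := by
  wlog h : t ≤ s generalizing s t
  · rw [abs_sub_comm, abs_sub_comm s]
    exact this ht hs (le_of_not_ge h)
  rw [abs_of_nonneg (sub_nonneg.2 (Real.exp_le_exp.2 h)), abs_of_nonneg (sub_nonneg.2 h)]
  have h1 := Real.add_one_le_exp (t - s)
  have h2 : Real.exp t = Real.exp s * Real.exp (t - s) := by rw [← Real.exp_add]; ring_nf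
  have h3 := Real.exp_le_exp.2 hs
  have h4 := Real.exp_pos s
  nlinarith

theorem abs_log_sub_log_le {c s t : ℝ} (hc : 0 < c) (hs : c ≤ s) (ht : c ≤ t) :
    |Real.log s - Real.log t| ≤ c⁻¹ * |s - t| := by
  wlog h : t ≤ s generalizing s t
  · rw [abs_sub_comm, abs_sub_comm s]
    exact this ht hs (le_of_not_ge h)
  have ht0 : 0 < t := hc.trans_le ht
  have hs0 : 0 < s := hc.trans_le hs
  rw [abs_of_nonneg (sub_nonneg.2 (Real.log_le_log ht0 h)), abs_of_nonneg (sub_nonneg.2 h),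
    ← Real.log_div hs0.ne' ht0.ne']
  have h1 := Real.log_le_sub_one_of_pos (div_pos hs0 ht0)
  have h2 : s / t - 1 = t⁻¹ * (s - t) := by field_simp
  rw [h2] at h1
  refine h1.trans ?_
  gcongr

theorem abs_inv_sub_inv_le {c s t : ℝ} (hc : 0 < c) (hs : c ≤ |s|) (ht : c ≤ |t|) :
    |s⁻¹ - t⁻¹| ≤ (c⁻¹ * c⁻¹) * |s - t| := by
  have hs0 : s ≠ 0 := fun h => by simp [h] at hs; linarith
  have ht0 : t ≠ 0 := fun h => by simp [h] at ht; linarith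
  have : s⁻¹ - t⁻¹ = s⁻¹ * t⁻¹ * (t - s) := by field_simp
  rw [this, abs_mul, abs_mul, abs_inv, abs_inv, abs_sub_comm t]
  gcongr

section Families

variable {B : Type*} {σ : B → B → ℝ} {a : ℝ} {l : ℕ} {g h : B → ℝ → ℝ}

theorem LipFamily.congr (hg : LipFamily σ a g) (hgh : ∀ b, ∀ x ∈ Icc 0 a, h b x = g b x) :
    LipFamily σ a h := by
  obtain ⟨M, h0, h1, h2, h3⟩ := hg
  refine ⟨M, h0, fun b x hx => ?_, fun b x hx y hy => ?_, fun b b' x hx => ?_⟩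
  · rw [hgh b x hx]; exact h1 b x hx
  · rw [hgh b x hx, hgh b y hy]; exact h2 b x hx y hy
  · rw [hgh b x hx, hgh b' x hx]; exact h3 b b' x hx

theorem SmoothFamily.lip (hg : SmoothFamily σ a l g) : LipFamily σ a g := by
  cases l with
  | zero => exact hg
  | succ l => exact hg.1

theorem SmoothFamily.congr (hg : SmoothFamily σ a l g) (hgh : ∀ b, ∀ x ∈ Icc 0 a, h b x = g b x) :
    SmoothFamily σ a l h := by
  cases l with
  | zero => exact LipFamily.congr hg hgh
  | succ l =>
    obtain ⟨g', h1, h2⟩ := hg.2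
    exact ⟨hg.1.congr hgh, g', fun b x hx => (h1 b x hx).congr (fun y hy => hgh b y hy) (hgh b x hx),
      h2⟩

theorem SmoothFamily.of_succ (hg : SmoothFamily σ a (l + 1) g) : SmoothFamily σ a l g := by
  induction l generalizing g with
  | zero => exact hg.1
  | succ l ih =>
    obtain ⟨g', h1, h2⟩ := hg.2
    exact ⟨hg.1, g', h1, ih h2⟩

theorem LipFamily.mono_interval {a' : ℝ} (hg : LipFamily σ a g) (ha : a' ≤ a) :
    LipFamily σ a' g := by
  obtain ⟨M, h0, h1, h2, h3⟩ := hg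
  have hs : Icc 0 a' ⊆ Icc 0 a := Icc_subset_Icc_right ha
  exact ⟨M, h0, fun b x hx => h1 b x (hs hx), fun b x hx y hy => h2 b x (hs hx) y (hs hy),
    fun b b' x hx => h3 b b' x (hs hx)⟩

theorem SmoothFamily.mono_interval {a' : ℝ} (hg : SmoothFamily σ a l g) (ha : a' ≤ a) :
    SmoothFamily σ a' l g := by
  induction l generalizing g with
  | zero => exact LipFamily.mono_interval hg ha
  | succ l ih =>
    obtain ⟨g', h1, h2⟩ := hg.2
    have hs : Icc 0 a' ⊆ Icc 0 a := Icc_subset_Icc_right ha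
    exact ⟨hg.1.mono_interval ha, g', fun b x hx => (h1 b x (hs hx)).mono hs, ih h2⟩

theorem WeightedFamily.mono_interval {a' : ℝ} (hg : WeightedFamily σ a g) (ha : a' ≤ a) :
    WeightedFamily σ a' g := by
  obtain ⟨M, h0, h2, h3⟩ := hg
  have hs : Icc 0 a' ⊆ Icc 0 a := Icc_subset_Icc_right ha
  exact ⟨M, h0, fun b x hx y hy => h2 b x (hs hx) y (hs hy), fun b b' x hx => h3 b b' x (hs hx)⟩

theorem LipFamily.neg (hg : LipFamily σ a g) : LipFamily σ a (fun b x => -g b x) := by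
  obtain ⟨M, h0, h1, h2, h3⟩ := hg
  refine ⟨M, h0, fun b x hx => by simpa using h1 b x hx, fun b x hx y hy => ?_, fun b b' x hx => ?_⟩
  · rw [neg_sub_neg, abs_sub_comm]; exact h2 b x hx y hy
  · rw [neg_sub_neg, abs_sub_comm]; exact h3 b b' x hx

theorem SmoothFamily.neg (hg : SmoothFamily σ a l g) :
    SmoothFamily σ a l (fun b x => -g b x) := by
  induction l generalizing g with
  | zero => exact LipFamily.neg hg
  | succ l ih =>
    obtain ⟨g', h1, h2⟩ := hg.2
    exact ⟨hg.1.neg, _, fun b x hx => (h1 b x hx).neg, ih h2⟩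

theorem LipFamily.add (hg : LipFamily σ a g) (hh : LipFamily σ a h) :
    LipFamily σ a (fun b x => g b x + h b x) := by
  obtain ⟨M, h0, h1, h2, h3⟩ := hg
  obtain ⟨N, k0, k1, k2, k3⟩ := hh
  refine ⟨M + N, by positivity, fun b x hx => ?_, fun b x hx y hy => ?_, fun b b' x hx => ?_⟩
  · exact (abs_add_le _ _).trans (add_le_add (h1 b x hx) (k1 b x hx))
  · rw [add_sub_add_comm, add_mul]
    exact (abs_add_le _ _).trans (add_le_add (h2 b x hx y hy) (k2 b x hx y hy))
  · rw [add_sub_add_comm, add_mul]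
    exact (abs_add_le _ _).trans (add_le_add (h3 b b' x hx) (k3 b b' x hx))

theorem SmoothFamily.add (hg : SmoothFamily σ a l g) (hh : SmoothFamily σ a l h) :
    SmoothFamily σ a l (fun b x => g b x + h b x) := by
  induction l generalizing g h with
  | zero => exact LipFamily.add hg hh
  | succ l ih =>
    obtain ⟨g', h1, h2⟩ := hg.2
    obtain ⟨h', k1, k2⟩ := hh.2
    exact ⟨hg.1.add hh.1, _, fun b x hx => (h1 b x hx).add (k1 b x hx), ih h2 k2⟩

theorem SmoothFamily.sub (hg : SmoothFamily σ a l g) (hh : SmoothFamily σ a l h) :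
    SmoothFamily σ a l (fun b x => g b x - h b x) := by
  simpa only [sub_eq_add_neg] using hg.add hh.neg

theorem abs_mul_sub_mul_le {u v u' v' M N D E : ℝ} (hu : |u| ≤ M) (hv' : |v'| ≤ N)
    (h1 : |u - u'| ≤ D) (h2 : |v - v'| ≤ E) : |u * v - u' * v'| ≤ M * E + N * D := by
  have : u * v - u' * v' = u * (v - v') + v' * (u - u') := by ring
  rw [this]
  refine (abs_add_le _ _).trans ?_
  rw [abs_mul, abs_mul]
  have := (abs_nonneg u).trans hu
  have := (abs_nonneg v').trans hv'
  gcongr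

theorem LipFamily.mul (hg : LipFamily σ a g) (hh : LipFamily σ a h) :
    LipFamily σ a (fun b x => g b x * h b x) := by
  obtain ⟨M, h0, h1, h2, h3⟩ := hg
  obtain ⟨N, k0, k1, k2, k3⟩ := hh
  have hMN : M * N ≤ 2 * (M * N) := by nlinarith [mul_nonneg h0 k0]
  refine ⟨2 * (M * N), by positivity, fun b x hx => ?_, fun b x hx y hy => ?_,
    fun b b' x hx => ?_⟩
  · rw [abs_mul]
    exact (mul_le_mul (h1 b x hx) (k1 b x hx) (abs_nonneg _) h0).trans hMN
  · refine (abs_mul_sub_mul_le (h1 b x hx) (k1 b y hy) (h2 b x hx y hy) (k2 b x hx y hy)).trans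
      (le_of_eq (by ring))
  · refine (abs_mul_sub_mul_le (h1 b x hx) (k1 b' x hx) (h3 b b' x hx) (k3 b b' x hx)).trans
      (le_of_eq (by ring))

theorem SmoothFamily.mul (hg : SmoothFamily σ a l g) (hh : SmoothFamily σ a l h) :
    SmoothFamily σ a l (fun b x => g b x * h b x) := by
  induction l generalizing g h with
  | zero => exact LipFamily.mul hg hh
  | succ l ih =>
    obtain ⟨g', h1, h2⟩ := hg.2
    obtain ⟨h', k1, k2⟩ := hh.2
    exact ⟨hg.1.mul hh.1, _, fun b x hx => (h1 b x hx).mul (k1 b x hx),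
      (ih h2 hh.of_succ).add (ih hg.of_succ k2)⟩

theorem SmoothFamily.zero : SmoothFamily σ a l (fun _ _ => 0) := by
  induction l with
  | zero =>
    refine ⟨0, le_rfl, ?_, ?_, ?_⟩ <;> simp
  | succ l ih =>
    exact ⟨SmoothFamily.lip ih, _, fun b x hx => hasDerivWithinAt_const _ _ _, ih⟩

/-- A function of the parameter alone. -/
theorem SmoothFamily.of_base (hσ : ∀ b b', 0 ≤ σ b b') {c : B → ℝ} {M : ℝ} (hM : ∀ b, |c b| ≤ M)
    {N : ℝ} (hN : ∀ b b', |c b - c b'| ≤ N * σ b b') : SmoothFamily σ a l (fun b _ => c b) := by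
  have h0 : LipFamily σ a (fun b _ => c b) := by
    refine ⟨max 0 (max M N), le_max_left _ _, fun b x hx => ?_, fun b x hx y hy => ?_,
      fun b b' x hx => ?_⟩
    · exact (hM b).trans ((le_max_left _ _).trans (le_max_right _ _))
    · simp only [sub_self, abs_zero]; positivity
    · refine (hN b b').trans (mul_le_mul_of_nonneg_right ?_ (hσ b b'))
      exact (le_max_right _ _).trans (le_max_right _ _)
  cases l with
  | zero => exact h0
  | succ l => exact ⟨h0, _, fun b x hx => hasDerivWithinAt_const _ _ _, SmoothFamily.zero⟩

theorem SmoothFamily.const (hσ : ∀ b b', 0 ≤ σ b b') (c : ℝ) :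
    SmoothFamily σ a l (fun _ _ => c) :=
  SmoothFamily.of_base hσ (M := |c|) (fun _ => le_rfl) (N := 0) (fun _ _ => by simp)

theorem SmoothFamily.id (hσ : ∀ b b', 0 ≤ σ b b') :
    SmoothFamily σ a l (fun _ x => x) := by
  have h0 : LipFamily σ a (fun _ x => x) := by
    refine ⟨max 1 a, le_max_of_le_left zero_le_one, fun b x hx => ?_, fun b x hx y hy => ?_,
      fun b b' x hx => ?_⟩
    · rw [abs_of_nonneg hx.1]; exact hx.2.trans (le_max_right _ _)
    · exact le_mul_of_one_le_left (abs_nonneg _) (le_max_left _ _)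
    · simp only [sub_self, abs_zero]
      exact mul_nonneg (le_max_of_le_left zero_le_one) (hσ b b')
  cases l with
  | zero => exact h0
  | succ l => exact ⟨h0, _, fun b x hx => hasDerivWithinAt_id _ _, SmoothFamily.const hσ 1⟩

/-- Outer functions whose value and derivatives are controlled on the range of a family. -/
theorem LipFamily.comp_left {Φ : ℝ → ℝ} {K : ℝ} (hK : 0 ≤ K) (hσ : ∀ b b', 0 ≤ σ b b')
    (hg : LipFamily σ a g) (h1 : ∀ b, ∀ x ∈ Icc 0 a, |Φ (g b x)| ≤ K)
    (h2 : ∀ b b', ∀ x ∈ Icc 0 a, ∀ y ∈ Icc 0 a,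
      |Φ (g b x) - Φ (g b' y)| ≤ K * |g b x - g b' y|) :
    LipFamily σ a (fun b x => Φ (g b x)) := by
  obtain ⟨M, h0, k1, k2, k3⟩ := hg
  refine ⟨max K (K * M), le_max_of_le_left hK, fun b x hx => (h1 b x hx).trans (le_max_left _ _),
    fun b x hx y hy => ?_, fun b b' x hx => ?_⟩
  · calc _ ≤ K * |g b x - g b y| := h2 b b x hx y hy
      _ ≤ K * (M * |x - y|) := by gcongr; exact k2 b x hx y hy
      _ = K * M * |x - y| := by ring
      _ ≤ _ := by gcongr; exact le_max_right _ _
  · calc _ ≤ K * |g b x - g b' x| := h2 b b' x hx x hx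
      _ ≤ K * (M * σ b b') := by gcongr; exact k3 b b' x hx
      _ = K * M * σ b b' := by ring
      _ ≤ _ := mul_le_mul_of_nonneg_right (le_max_right _ _) (hσ b b')

theorem SmoothFamily.exp (hσ : ∀ b b', 0 ≤ σ b b') (hg : SmoothFamily σ a l g) :
    SmoothFamily σ a l (fun b x => Real.exp (g b x)) := by
  have h0 : LipFamily σ a (fun b x => Real.exp (g b x)) := by
    obtain ⟨M, -, k1, -, -⟩ := hg.lip
    refine hg.lip.comp_left (K := Real.exp M) (by positivity) hσ (fun b x hx => ?_)
      (fun b b' x hx y hy => ?_)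
    · rw [abs_of_pos (Real.exp_pos _)]
      exact Real.exp_le_exp.2 ((le_abs_self _).trans (k1 b x hx))
    · exact abs_exp_sub_exp_le ((le_abs_self _).trans (k1 b x hx)) ((le_abs_self _).trans (k1 b' y hy))
  induction l with
  | zero => exact h0
  | succ l ih =>
    obtain ⟨g', h1, h2⟩ := hg.2
    exact ⟨h0, _, fun b x hx => (h1 b x hx).exp, (ih hg.of_succ).mul h2⟩

theorem SmoothFamily.inv (hσ : ∀ b b', 0 ≤ σ b b') (hg : SmoothFamily σ a l g) {c : ℝ} (hc : 0 < c)
    (hgc : ∀ b, ∀ x ∈ Icc 0 a, c ≤ |g b x|) : SmoothFamily σ a l (fun b x => (g b x)⁻¹) := by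
  have h0 : LipFamily σ a (fun b x => (g b x)⁻¹) := by
    refine hg.lip.comp_left (Φ := fun t => t⁻¹) (K := max c⁻¹ (c⁻¹ * c⁻¹)) (by positivity) hσ
      (fun b x hx => ?_) (fun b b' x hx y hy => ?_)
    · rw [abs_inv]
      exact (inv_anti₀ hc (hgc b x hx)).trans (le_max_left _ _)
    · refine (abs_inv_sub_inv_le hc (hgc b x hx) (hgc b' y hy)).trans ?_
      gcongr
      exact le_max_right _ _
  induction l with
  | zero => exact h0
  | succ l ih =>
    obtain ⟨g', h1, h2⟩ := hg.2
    have hi := ih hg.of_succ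
    refine ⟨h0, fun b x => -(g' b x * ((g b x)⁻¹ * (g b x)⁻¹)), fun b x hx => ?_,
      (h2.mul (hi.mul hi)).neg⟩
    have hne : g b x ≠ 0 := abs_pos.1 (hc.trans_le (hgc b x hx))
    refine ((h1 b x hx).inv hne).congr_deriv ?_
    field_simp

theorem SmoothFamily.log (hσ : ∀ b b', 0 ≤ σ b b') (hg : SmoothFamily σ a l g) {c : ℝ} (hc : 0 < c)
    (hgc : ∀ b, ∀ x ∈ Icc 0 a, c ≤ g b x) : SmoothFamily σ a l (fun b x => Real.log (g b x)) := by
  have h0 : LipFamily σ a (fun b x => Real.log (g b x)) := by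
    obtain ⟨M, -, k1, -, -⟩ := hg.lip
    refine hg.lip.comp_left (K := max c⁻¹ (max |Real.log c| |Real.log M|)) (by positivity) hσ
      (fun b x hx => ?_) (fun b b' x hx y hy => ?_)
    · refine (abs_le_max_abs_abs (Real.log_le_log hc (hgc b x hx)) (Real.log_le_log
        (hc.trans_le (hgc b x hx)) ((le_abs_self _).trans (k1 b x hx)))).trans (le_max_right _ _)
    · refine (abs_log_sub_log_le hc (hgc b x hx) (hgc b' y hy)).trans ?_
      gcongr
      exact le_max_left _ _
  cases l with
  | zero => exact h0
  | succ l =>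
    obtain ⟨g', h1, h2⟩ := hg.2
    refine ⟨h0, fun b x => g' b x * (g b x)⁻¹, fun b x hx => ?_, h2.mul
      (hg.of_succ.inv hσ hc fun b x hx => (hgc b x hx).trans (le_abs_self _))⟩
    have hne : g b x ≠ 0 := (hc.trans_le (hgc b x hx)).ne'
    simpa [div_eq_mul_inv] using (h1 b x hx).log hne

end Families

section Composition

variable {B B' : Type*} {σ : B → B → ℝ} {σ' : B' → B' → ℝ} {a a' : ℝ} {l : ℕ} {g : B' → ℝ → ℝ}
  {φ : B → ℝ → ℝ} {τ : B → B'} {K : ℝ}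

theorem LipFamily.comp (hg : LipFamily σ' a' g) (hφ : LipFamily σ a φ)
    (hmaps : ∀ b, ∀ x ∈ Icc 0 a, φ b x ∈ Icc 0 a') (hσ : ∀ b b', 0 ≤ σ b b')
    (hτ : ∀ b b', σ' (τ b) (τ b') ≤ K * σ b b') :
    LipFamily σ a (fun b x => g (τ b) (φ b x)) := by
  obtain ⟨M, h0, h1, h2, h3⟩ := hg
  obtain ⟨N, k0, k1, k2, k3⟩ := hφ
  refine ⟨max M (max (M * N) (M * N + M * K)), le_max_of_le_left h0,
    fun b x hx => (h1 _ _ (hmaps b x hx)).trans (le_max_left _ _), fun b x hx y hy => ?_,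
    fun b b' x hx => ?_⟩
  · calc _ ≤ M * |φ b x - φ b y| := h2 _ _ (hmaps b x hx) _ (hmaps b y hy)
      _ ≤ M * (N * |x - y|) := by gcongr; exact k2 b x hx y hy
      _ = M * N * |x - y| := by ring
      _ ≤ _ := by gcongr; exact (le_max_left _ _).trans (le_max_right _ _)
  · calc _ ≤ |g (τ b) (φ b x) - g (τ b) (φ b' x)| + |g (τ b) (φ b' x) - g (τ b') (φ b' x)| :=
          abs_sub_le _ _ _
      _ ≤ M * (N * σ b b') + M * (K * σ b b') := by
          gcongr
          · refine (h2 _ _ (hmaps b x hx) _ (hmaps b' x hx)).trans ?_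
            gcongr; exact k3 b b' x hx
          · refine (h3 _ _ _ (hmaps b' x hx)).trans ?_
            gcongr; exact hτ b b'
      _ = (M * N + M * K) * σ b b' := by ring
      _ ≤ _ := mul_le_mul_of_nonneg_right ((le_max_right _ _).trans (le_max_right _ _)) (hσ b b')

theorem SmoothFamily.comp (hg : SmoothFamily σ' a' l g) (hφ : SmoothFamily σ a l φ)
    (hmaps : ∀ b, ∀ x ∈ Icc 0 a, φ b x ∈ Icc 0 a') (hσ : ∀ b b', 0 ≤ σ b b')
    (hτ : ∀ b b', σ' (τ b) (τ b') ≤ K * σ b b') :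
    SmoothFamily σ a l (fun b x => g (τ b) (φ b x)) := by
  induction l generalizing g with
  | zero => exact LipFamily.comp hg hφ hmaps hσ hτ
  | succ l ih =>
    obtain ⟨g', h1, h2⟩ := hg.2
    obtain ⟨φ', k1, k2⟩ := hφ.2
    exact ⟨hg.1.comp hφ.1 hmaps hσ hτ, _, fun b x hx =>
      (h1 (τ b) (φ b x) (hmaps b x hx)).comp x (k1 b x hx) (fun y hy => hmaps b y hy),
      (ih h2 hφ.of_succ).mul k2⟩

theorem SmoothFamily.mono_gauge {σ₁ σ₂ : B → B → ℝ} {g : B → ℝ → ℝ} (hg : SmoothFamily σ₁ a l g)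
    (hσ₂ : ∀ b b', 0 ≤ σ₂ b b') (h : ∀ b b', σ₁ b b' ≤ K * σ₂ b b') : SmoothFamily σ₂ a l g :=
  hg.comp (τ := fun b => b) (SmoothFamily.id hσ₂) (fun _ _ hx => hx) hσ₂ h

/-- A fiberwise inverse of a uniformly expanding smooth family is a smooth family. -/
theorem SmoothFamily.rightInverse {σ : B → B → ℝ} {p g : B → ℝ → ℝ} {c : ℝ} (ha : 0 < a)
    (hσ : ∀ b b', 0 ≤ σ b b') (hc : 0 < c) (hp : SmoothFamily σ a l p)
    (hexp : ∀ b, ∀ x ∈ Icc 0 a, ∀ y ∈ Icc 0 a, c * |x - y| ≤ |p b x - p b y|)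
    (hmaps : ∀ b, ∀ y ∈ Icc 0 a', g b y ∈ Icc 0 a) (hinv : ∀ b, ∀ y ∈ Icc 0 a', p b (g b y) = y) :
    SmoothFamily σ a' l g := by
  have hlip : ∀ b, ∀ x ∈ Icc 0 a', ∀ y ∈ Icc 0 a', |g b x - g b y| ≤ c⁻¹ * |x - y| := by
    intro b x hx y hy
    have := hexp b _ (hmaps b x hx) _ (hmaps b y hy)
    rw [hinv b x hx, hinv b y hy] at this
    rwa [inv_mul_eq_div, le_div_iff₀' hc]
  have h0 : LipFamily σ a' g := by
    obtain ⟨M, h0, -, -, h3⟩ := hp.lip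
    refine ⟨max a (max c⁻¹ (c⁻¹ * M)), by positivity, fun b x hx => ?_, fun b x hx y hy => ?_,
      fun b b' x hx => ?_⟩
    · have := hmaps b x hx
      rw [abs_of_nonneg this.1]
      exact this.2.trans (le_max_left _ _)
    · refine (hlip b x hx y hy).trans ?_
      gcongr
      exact (le_max_left _ _).trans (le_max_right _ _)
    · have h4 := hexp b _ (hmaps b x hx) _ (hmaps b' x hx)
      have h5 := h3 b b' _ (hmaps b' x hx)
      rw [hinv b' x hx, abs_sub_comm] at h5
      rw [hinv b x hx] at h4
      have h6 : |g b x - g b' x| ≤ c⁻¹ * (M * σ b b') := by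
        rw [inv_mul_eq_div, le_div_iff₀' hc]
        exact h4.trans h5
      refine h6.trans ?_
      rw [← mul_assoc]
      exact mul_le_mul_of_nonneg_right ((le_max_right _ _).trans (le_max_right _ _)) (hσ b b')
  induction l with
  | zero => exact h0
  | succ l ih =>
    obtain ⟨p', h1, h2⟩ := hp.2
    have hi := ih hp.of_succ
    have hp'c : ∀ b, ∀ x ∈ Icc 0 a, c ≤ |p' b x| := fun b x hx =>
      le_abs_deriv_of_expanding ha hx (h1 b x hx) fun y hy => hexp b y hy x hx
    have hc1 := (h2.inv hσ hc hp'c).comp (τ := fun b => b) (K := 1) hi hmaps hσ (fun b b' => by simp)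
    refine ⟨h0, _, fun b y hy => ?_, hc1⟩
    obtain ⟨M, hM0, -, hM, -⟩ := h2.lip
    refine hasDerivWithinAt_of_quadratic_bound (M := c⁻¹ * (M * (c⁻¹ * c⁻¹))) fun z hz => ?_
    have ht := abs_taylor_one_le hM0 (h1 b) (hM b) (hmaps b y hy) (hmaps b z hz)
    rw [hinv b y hy, hinv b z hz] at ht
    set d := p' b (g b y) with hd
    have hdc : c ≤ |d| := hp'c b _ (hmaps b y hy)
    have hd0 : d ≠ 0 := abs_pos.1 (hc.trans_le hdc)
    have he : g b z - g b y - d⁻¹ * (z - y) = -d⁻¹ * (z - y - d * (g b z - g b y)) := by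
      field_simp; ring
    rw [he, abs_mul, abs_neg, abs_inv]
    calc _ ≤ c⁻¹ * (M * (c⁻¹ * |z - y|) ^ 2) := by
          have h7 := hlip b z hz y hy
          gcongr
          refine ht.trans ?_
          gcongr
      _ = _ := by ring

end Composition

/-! ### The linear equation `W = R + m · W ∘ F` -/

/-- A quantity `E` that is dominated along the orbits of `Φ` by itself up to an error `R` is dominated
by `R`, provided that the a priori bound `D` and the error decay along the orbits. -/
theorem le_of_recursive_bound {X : Type*} {S : Set X} {Φ : X → X} (hΦ : MapsTo Φ S S)
    {E R D : X → ℝ} {s θ η : ℝ} (hs : 0 ≤ s) (hθ : θ < 1) (hη0 : 0 ≤ η) (hη : η < 1)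
    (hR0 : ∀ p ∈ S, 0 ≤ R p) (hE : ∀ p ∈ S, E p ≤ R p + s * E (Φ p)) (hED : ∀ p ∈ S, E p ≤ D p)
    (hD : ∀ p ∈ S, s * D (Φ p) ≤ η * D p) (hR : ∀ p ∈ S, s * R (Φ p) ≤ θ * R p) :
    ∀ p ∈ S, E p ≤ (1 - θ)⁻¹ * R p := by
  have hθ' : 0 < 1 - θ := sub_pos.2 hθ
  have key : ∀ n : ℕ, ∀ p ∈ S, E p ≤ (1 - θ)⁻¹ * R p + η ^ n * D p := by
    intro n
    induction n with
    | zero =>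
      intro p hp
      have := mul_nonneg (inv_nonneg.2 hθ'.le) (hR0 p hp)
      simpa using (hED p hp).trans (le_add_of_nonneg_left this)
    | succ n ih =>
      intro p hp
      have h1 := hE p hp
      have h2 := mul_le_mul_of_nonneg_left (ih _ (hΦ hp)) hs
      have h3 := mul_le_mul_of_nonneg_left (hR p hp) (inv_nonneg.2 hθ'.le)
      have h4 := mul_le_mul_of_nonneg_left (hD p hp) (pow_nonneg hη0 n)
      have h5 : R p + (1 - θ)⁻¹ * (θ * R p) = (1 - θ)⁻¹ * R p := by
        field_simp; ring
      calc E p ≤ R p + (1 - θ)⁻¹ * (s * R (Φ p)) + η ^ n * (s * D (Φ p)) := by linarith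
        _ ≤ R p + (1 - θ)⁻¹ * (θ * R p) + η ^ n * (η * D p) := by linarith
        _ = _ := by rw [h5]; ring
  intro p hp
  refine ge_of_tendsto' (x := Filter.atTop) ?_ (fun n => key n p hp)
  have := ((tendsto_pow_atTop_nhds_zero_of_lt_one hη0 hη).mul_const (D p)).const_add
    ((1 - θ)⁻¹ * R p)
  simpa using this

/-- The solution is the sum of the series of the iterated transfers of `R`. -/
theorem exists_bounded_solution {X : Type*} {S : Set X} {F : X → X} (hF : MapsTo F S S)
    {m R D : X → ℝ} {θ : ℝ} (hθ0 : 0 ≤ θ) (hθ : θ < 1)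
    (hR : ∀ p ∈ S, |R p| ≤ D p) (hD : ∀ p ∈ S, |m p| * D (F p) ≤ θ * D p) :
    ∃ W : X → ℝ, (∀ p ∈ S, W p = R p + m p * W (F p)) ∧ ∀ p ∈ S, |W p| ≤ (1 - θ)⁻¹ * D p := by
  let c : ℕ → X → ℝ := fun n => Nat.rec R (fun _ u p => m p * u (F p)) n
  have hc0 : ∀ p, c 0 p = R p := fun p => rfl
  have hcs : ∀ n p, c (n + 1) p = m p * c n (F p) := fun n p => rfl
  have hc : ∀ n, ∀ p ∈ S, |c n p| ≤ D p * θ ^ n := by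
    intro n
    induction n with
    | zero => intro p hp; simpa [hc0] using hR p hp
    | succ n ih =>
      intro p hp
      rw [hcs, abs_mul]
      calc _ ≤ |m p| * (D (F p) * θ ^ n) := mul_le_mul_of_nonneg_left (ih _ (hF hp)) (abs_nonneg _)
        _ = (|m p| * D (F p)) * θ ^ n := by ring
        _ ≤ (θ * D p) * θ ^ n := mul_le_mul_of_nonneg_right (hD p hp) (pow_nonneg hθ0 n)
        _ = _ := by ring
  have hgeo := fun p => (summable_geometric_of_lt_one hθ0 hθ).mul_left (D p)
  have hsum : ∀ p ∈ S, Summable (fun n => c n p) := fun p hp =>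
    Summable.of_norm_bounded (hgeo p) (fun n => hc n p hp)
  refine ⟨fun p => ∑' n, c n p, fun p hp => ?_, fun p hp => ?_⟩
  · dsimp only
    rw [(hsum p hp).tsum_eq_zero_add, hc0]
    simp only [hcs, tsum_mul_left]
  · have := tsum_of_norm_bounded (f := fun n => c n p) (hgeo p).hasSum (fun n => hc n p hp)
    rw [tsum_mul_left, tsum_geometric_of_lt_one hθ0 hθ, mul_comm] at this
    exact this

section Solution

variable {B : Type*} {T : B → B} {σ : B → B → ℝ} {a q : ℝ} {f W R m : B → ℝ → ℝ}

/-- Solutions are Lipschitz along the fibers. The a priori bound `D` decays along the orbits, which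
covers both bounded solutions (`D` constant, `s < 1`) and solutions vanishing at `x = 0` (`D` linear,
`s = 1`). -/
theorem abs_solution_sub_le_fiber {s η C : ℝ} {D : ℝ → ℝ} (hs : 0 ≤ s) (hs1 : s ≤ 1)
    (hq : q < 1) (hη0 : 0 ≤ η) (hη : η < 1) (hC : 0 ≤ C)
    (hf : ∀ b, ∀ x ∈ Icc 0 a, f b x ∈ Icc 0 a)
    (hfq : ∀ b, ∀ x ∈ Icc 0 a, ∀ y ∈ Icc 0 a, |f b x - f b y| ≤ q * |x - y|)
    (hm : ∀ b, ∀ x ∈ Icc 0 a, |m b x| ≤ s)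
    (hD : ∀ b, ∀ x ∈ Icc 0 a, s * D (f b x) ≤ η * D x)
    (hW : ∀ b, ∀ x ∈ Icc 0 a, W b x = R b x + m b x * W (T b) (f b x))
    (hWD : ∀ b, ∀ x ∈ Icc 0 a, |W b x| ≤ D x)
    (hRC : ∀ b, ∀ x ∈ Icc 0 a, ∀ y ∈ Icc 0 a, |R b x - R b y| ≤ C * |x - y|)
    (hmC : ∀ b, ∀ x ∈ Icc 0 a, ∀ y ∈ Icc 0 a,
      |m b x - m b y| * |W (T b) (f b y)| ≤ C * |x - y|) :
    ∀ b, ∀ x ∈ Icc 0 a, ∀ y ∈ Icc 0 a, |W b x - W b y| ≤ (1 - q)⁻¹ * (2 * C * |x - y|) := by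
  intro b x hx y hy
  refine le_of_recursive_bound (X := B × ℝ × ℝ) (S := univ ×ˢ Icc 0 a ×ˢ Icc 0 a)
    (Φ := fun p => (T p.1, f p.1 p.2.1, f p.1 p.2.2)) (E := fun p => |W p.1 p.2.1 - W p.1 p.2.2|)
    (R := fun p => 2 * C * |p.2.1 - p.2.2|) (D := fun p => D p.2.1 + D p.2.2) (s := s)
    ?_ hs hq hη0 hη ?_ ?_ ?_ ?_ ?_ (b, x, y) ⟨mem_univ _, hx, hy⟩
  · rintro ⟨b, x, y⟩ ⟨-, hx, hy⟩
    exact ⟨mem_univ _, hf b x hx, hf b y hy⟩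
  · rintro ⟨b, x, y⟩ -
    dsimp only
    positivity
  · rintro ⟨b, x, y⟩ ⟨-, hx, hy⟩
    dsimp only at hx hy ⊢
    rw [hW b x hx, hW b y hy]
    have e : R b x + m b x * W (T b) (f b x) - (R b y + m b y * W (T b) (f b y)) =
        (R b x - R b y) + ((m b x - m b y) * W (T b) (f b y) +
          m b x * (W (T b) (f b x) - W (T b) (f b y))) := by ring
    rw [e]
    have h1 := hRC b x hx y hy
    have h2 := hmC b x hx y hy
    rw [← abs_mul] at h2
    have h3 : |m b x * (W (T b) (f b x) - W (T b) (f b y))| ≤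
        s * |W (T b) (f b x) - W (T b) (f b y)| := by
      rw [abs_mul]; gcongr; exact hm b x hx
    have h4 := abs_add_le (R b x - R b y) ((m b x - m b y) * W (T b) (f b y) +
          m b x * (W (T b) (f b x) - W (T b) (f b y)))
    have h5 := abs_add_le ((m b x - m b y) * W (T b) (f b y))
      (m b x * (W (T b) (f b x) - W (T b) (f b y)))
    linarith
  · rintro ⟨b, x, y⟩ ⟨-, hx, hy⟩
    exact (abs_sub _ _).trans (add_le_add (hWD b x hx) (hWD b y hy))
  · rintro ⟨b, x, y⟩ ⟨-, hx, hy⟩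
    have h1 := hD b x hx
    have h2 := hD b y hy
    dsimp only
    linarith
  · rintro ⟨b, x, y⟩ ⟨-, hx, hy⟩
    have h1 := hfq b x hx y hy
    have h2 := abs_nonneg (f b x - f b y)
    dsimp only
    calc s * (2 * C * |f b x - f b y|) ≤ 1 * (2 * C * |f b x - f b y|) := by gcongr
      _ ≤ 1 * (2 * C * (q * |x - y|)) := by gcongr
      _ = _ := by ring

/-- Dependence of the solution on the parameter, with a weight `ω` in the fiber variable: one step of
the base map expands the gauge by at most `κ`, which the decay of `s * ω` has to compensate. -/
theorem abs_solution_sub_le_base {s η θ C L : ℝ} {D ω : ℝ → ℝ} (hs : 0 ≤ s)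
    (hη0 : 0 ≤ η) (hη : η < 1) (hθ : θ < 1) (hL : 0 ≤ L)
    (hf : ∀ b, ∀ x ∈ Icc 0 a, f b x ∈ Icc 0 a)
    (hm : ∀ b, ∀ x ∈ Icc 0 a, |m b x| ≤ s)
    (hD : ∀ b, ∀ x ∈ Icc 0 a, s * D (f b x) ≤ η * D x)
    (hω0 : ∀ b b', ∀ x ∈ Icc 0 a, 0 ≤ ω x * σ b b')
    (hω : ∀ b b' b'', ∀ x ∈ Icc 0 a,
      s * (ω (f b x) * σ (T b') (T b'')) ≤ θ * (ω x * σ b' b''))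
    (hW : ∀ b, ∀ x ∈ Icc 0 a, W b x = R b x + m b x * W (T b) (f b x))
    (hWD : ∀ b, ∀ x ∈ Icc 0 a, |W b x| ≤ D x)
    (hWL : ∀ b, ∀ x ∈ Icc 0 a, ∀ y ∈ Icc 0 a, |W b x - W b y| ≤ L * |x - y|)
    (hRC : ∀ b b', ∀ x ∈ Icc 0 a, |R b x - R b' x| ≤ C * (ω x * σ b b'))
    (hfC : ∀ b b', ∀ x ∈ Icc 0 a, |f b x - f b' x| ≤ C * (ω x * σ b b'))
    (hmC : ∀ b b', ∀ x ∈ Icc 0 a,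
      |m b x - m b' x| * |W (T b') (f b' x)| ≤ C * (ω x * σ b b')) (hC : 0 ≤ C) :
    ∀ b b', ∀ x ∈ Icc 0 a,
      |W b x - W b' x| ≤ (1 - θ)⁻¹ * ((2 * C + s * (L * C)) * (ω x * σ b b')) := by
  intro b b' x hx
  refine le_of_recursive_bound (X := B × B × ℝ) (S := univ ×ˢ univ ×ˢ Icc 0 a)
    (Φ := fun p => (T p.1, T p.2.1, f p.2.1 p.2.2)) (E := fun p => |W p.1 p.2.2 - W p.2.1 p.2.2|)
    (R := fun p => (2 * C + s * (L * C)) * (ω p.2.2 * σ p.1 p.2.1))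
    (D := fun p => D p.2.2 + D p.2.2) (s := s)
    ?_ hs hθ hη0 hη ?_ ?_ ?_ ?_ ?_ (b, b', x) ⟨mem_univ _, mem_univ _, hx⟩
  · rintro ⟨b, b', x⟩ ⟨-, -, hx⟩
    exact ⟨mem_univ _, mem_univ _, hf b' x hx⟩
  · rintro ⟨b, b', x⟩ ⟨-, -, hx⟩
    have := hω0 b b' x hx
    dsimp only
    positivity
  · rintro ⟨b, b', x⟩ ⟨-, -, hx⟩
    dsimp only at hx ⊢
    rw [hW b x hx, hW b' x hx]
    have e : R b x + m b x * W (T b) (f b x) - (R b' x + m b' x * W (T b') (f b' x)) =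
        (R b x - R b' x) + ((m b x - m b' x) * W (T b') (f b' x) +
          m b x * ((W (T b) (f b x) - W (T b) (f b' x)) +
            (W (T b) (f b' x) - W (T b') (f b' x)))) := by ring
    rw [e]
    have h1 := hRC b b' x hx
    have h2 := hmC b b' x hx
    rw [← abs_mul] at h2
    have h6 : |W (T b) (f b x) - W (T b) (f b' x)| ≤ L * (C * (ω x * σ b b')) := by
      refine (hWL _ _ (hf b x hx) _ (hf b' x hx)).trans ?_
      gcongr; exact hfC b b' x hx
    have h3 : |m b x * ((W (T b) (f b x) - W (T b) (f b' x)) +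
            (W (T b) (f b' x) - W (T b') (f b' x)))| ≤
        s * (L * (C * (ω x * σ b b')) + |W (T b) (f b' x) - W (T b') (f b' x)|) := by
      rw [abs_mul]
      gcongr
      · exact hm b x hx
      · refine (abs_add_le _ _).trans ?_
        gcongr
    have h4 := abs_add_le (R b x - R b' x) ((m b x - m b' x) * W (T b') (f b' x) +
          m b x * ((W (T b) (f b x) - W (T b) (f b' x)) +
            (W (T b) (f b' x) - W (T b') (f b' x))))
    have h5 := abs_add_le ((m b x - m b' x) * W (T b') (f b' x))
      (m b x * ((W (T b) (f b x) - W (T b) (f b' x)) + (W (T b) (f b' x) - W (T b') (f b' x))))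
    linarith
  · rintro ⟨b, b', x⟩ ⟨-, -, hx⟩
    exact (abs_sub _ _).trans (add_le_add (hWD b x hx) (hWD b' x hx))
  · rintro ⟨b, b', x⟩ ⟨-, -, hx⟩
    have h1 := hD b' x hx
    dsimp only
    linarith
  · rintro ⟨b, b', x⟩ ⟨-, -, hx⟩
    have h1 := hω b' b b' x hx
    dsimp only at h1 ⊢
    have h2 : 0 ≤ 2 * C + s * (L * C) := by positivity
    calc _ = (2 * C + s * (L * C)) * (s * (ω (f b' x) * σ (T b) (T b'))) := by ring
      _ ≤ (2 * C + s * (L * C)) * (θ * (ω x * σ b b')) := by gcongr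
      _ = _ := by ring

/-- A bounded solution `V` of the formally differentiated equation is the fiber derivative of the
solution `W`. -/
theorem hasDerivWithinAt_solution {f' R' m' V : B → ℝ → ℝ} {L C : ℝ} (hq0 : 0 ≤ q) (hq : q < 1)
    (hL : 0 ≤ L) (hC : 0 ≤ C)
    (hf : ∀ b, ∀ x ∈ Icc 0 a, f b x ∈ Icc 0 a)
    (hfq : ∀ b, ∀ x ∈ Icc 0 a, ∀ y ∈ Icc 0 a, |f b x - f b y| ≤ q * |x - y|)
    (hm : ∀ b, ∀ x ∈ Icc 0 a, |m b x| ≤ 1)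
    (hW : ∀ b, ∀ x ∈ Icc 0 a, W b x = R b x + m b x * W (T b) (f b x))
    (hV : ∀ b, ∀ x ∈ Icc 0 a, V b x = R' b x + m' b x * W (T b) (f b x) +
      m b x * f' b x * V (T b) (f b x))
    (hWb : ∀ b, ∀ x ∈ Icc 0 a, |W b x| ≤ L)
    (hWL : ∀ b, ∀ x ∈ Icc 0 a, ∀ y ∈ Icc 0 a, |W b x - W b y| ≤ L * |x - y|)
    (hVL : ∀ b, ∀ x ∈ Icc 0 a, |V b x| ≤ L)
    (hRt : ∀ b, ∀ x ∈ Icc 0 a, ∀ y ∈ Icc 0 a,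
      |R b y - R b x - R' b x * (y - x)| ≤ C * |y - x| ^ 2)
    (hmt : ∀ b, ∀ x ∈ Icc 0 a, ∀ y ∈ Icc 0 a,
      |m b y - m b x - m' b x * (y - x)| ≤ C * |y - x| ^ 2)
    (hft : ∀ b, ∀ x ∈ Icc 0 a, ∀ y ∈ Icc 0 a,
      |f b y - f b x - f' b x * (y - x)| ≤ C * |y - x| ^ 2)
    (hmL : ∀ b, ∀ x ∈ Icc 0 a, ∀ y ∈ Icc 0 a, |m b x - m b y| ≤ C * |x - y|) :
    ∀ b, ∀ x ∈ Icc 0 a, HasDerivWithinAt (W b) (V b x) (Icc 0 a) x := by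
  intro b x hx
  have hq2 : q ^ 2 < 1 := by nlinarith
  refine hasDerivWithinAt_of_quadratic_bound
    (M := (1 - q ^ 2)⁻¹ * (C + C * L + C * (L * q) + L * C)) fun y hy => ?_
  rw [mul_assoc]
  refine le_of_recursive_bound (X := B × ℝ × ℝ) (S := univ ×ˢ Icc 0 a ×ˢ Icc 0 a)
    (Φ := fun p => (T p.1, f p.1 p.2.1, f p.1 p.2.2))
    (E := fun p => |W p.1 p.2.2 - W p.1 p.2.1 - V p.1 p.2.1 * (p.2.2 - p.2.1)|)
    (R := fun p => (C + C * L + C * (L * q) + L * C) * |p.2.2 - p.2.1| ^ 2)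
    (D := fun p => 2 * L * |p.2.2 - p.2.1|) (s := 1)
    ?_ zero_le_one hq2 hq0 hq ?_ ?_ ?_ ?_ ?_ (b, x, y) ⟨mem_univ _, hx, hy⟩
  · rintro ⟨b, x, y⟩ ⟨-, hx, hy⟩
    exact ⟨mem_univ _, hf b x hx, hf b y hy⟩
  · rintro ⟨b, x, y⟩ -
    dsimp only
    positivity
  · rintro ⟨b, x, y⟩ ⟨-, hx, hy⟩
    dsimp only at hx hy ⊢
    have hx' := hf b x hx
    have hy' := hf b y hy
    rw [hW b x hx, hW b y hy, hV b x hx]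
    set u := f b x
    set v := f b y
    have e : R b y + m b y * W (T b) v - (R b x + m b x * W (T b) u) -
        (R' b x + m' b x * W (T b) u + m b x * f' b x * V (T b) u) * (y - x) =
        (R b y - R b x - R' b x * (y - x)) + ((m b y - m b x - m' b x * (y - x)) * W (T b) u +
        ((m b y - m b x) * (W (T b) v - W (T b) u) +
        (m b x * (V (T b) u * (v - u - f' b x * (y - x))) +
          m b x * (W (T b) v - W (T b) u - V (T b) u * (v - u))))) := by ring
    rw [e]
    have hvu : |v - u| ≤ q * |y - x| := hfq b y hy x hx
    have h1 := hRt b x hx y hy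
    have h2 : |(m b y - m b x - m' b x * (y - x)) * W (T b) u| ≤ C * |y - x| ^ 2 * L := by
      rw [abs_mul]
      gcongr
      · exact hmt b x hx y hy
      · exact hWb _ _ hx'
    have h3 : |(m b y - m b x) * (W (T b) v - W (T b) u)| ≤ C * |y - x| * (L * (q * |y - x|)) := by
      rw [abs_mul]
      gcongr
      · exact hmL b y hy x hx
      · exact (hWL _ _ hy' _ hx').trans (by gcongr)
    have h4 : |m b x * (V (T b) u * (v - u - f' b x * (y - x)))| ≤ 1 * (L * (C * |y - x| ^ 2)) := by
      rw [abs_mul, abs_mul]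
      gcongr
      · exact hm b x hx
      · exact hVL _ _ hx'
      · exact hft b x hx y hy
    have h5 : |m b x * (W (T b) v - W (T b) u - V (T b) u * (v - u))| ≤
        1 * |W (T b) v - W (T b) u - V (T b) u * (v - u)| := by
      rw [abs_mul]; gcongr; exact hm b x hx
    refine (abs_add_le _ _).trans ?_
    refine (add_le_add h1 ((abs_add_le _ _).trans (add_le_add h2 ((abs_add_le _ _).trans
      (add_le_add h3 ((abs_add_le _ _).trans (add_le_add h4 h5))))))).trans (le_of_eq ?_)
    ring
  · rintro ⟨b, x, y⟩ ⟨-, hx, hy⟩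
    dsimp only at hx hy ⊢
    have h1 := hWL b y hy x hx
    have h2 : |V b x * (y - x)| ≤ L * |y - x| := by
      rw [abs_mul]; gcongr; exact hVL b x hx
    have := abs_sub (W b y - W b x) (V b x * (y - x))
    linarith
  · rintro ⟨b, x, y⟩ ⟨-, hx, hy⟩
    dsimp only at hx hy ⊢
    have h1 := hfq b y hy x hx
    calc _ ≤ 1 * (2 * L * (q * |y - x|)) := by gcongr
      _ = _ := by ring
  · rintro ⟨b, x, y⟩ ⟨-, hx, hy⟩
    dsimp only at hx hy ⊢
    have h1 := hfq b y hy x hx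
    calc _ ≤ 1 * ((C + C * L + C * (L * q) + L * C) * (q * |y - x|) ^ 2) := by gcongr
      _ = _ := by ring

/-- Regularity of solutions: a Lipschitz solution of the linear equation is as smooth along the fibers
as its data, and all its fiber derivatives depend on the parameter like the data. Each derivative
solves an equation of the same form, with an additional factor `f'` in `m`; this factor compensates
the expansion `κ` of the gauge. -/
theorem SmoothFamily.solution {l : ℕ} {κ : ℝ} (ha : 0 < a) (hσ : ∀ b b', 0 ≤ σ b b')
    (hκ : ∀ b b', σ (T b) (T b') ≤ κ * σ b b') (hq0 : 0 ≤ q) (hq : q < 1) (hqκ : q * κ < 1)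
    (hf : ∀ b, ∀ x ∈ Icc 0 a, f b x ∈ Icc 0 a)
    (hfq : ∀ b, ∀ x ∈ Icc 0 a, ∀ y ∈ Icc 0 a, |f b x - f b y| ≤ q * |x - y|)
    (hfl : SmoothFamily σ a l f) (hRl : SmoothFamily σ a l R) (hml : SmoothFamily σ a l m)
    (hm : ∀ b, ∀ x ∈ Icc 0 a, |m b x| ≤ 1)
    (hW : ∀ b, ∀ x ∈ Icc 0 a, W b x = R b x + m b x * W (T b) (f b x))
    (hWL : LipFamily σ a W) : SmoothFamily σ a l W := by
  induction l generalizing R m W with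
  | zero => exact hWL
  | succ l ih =>
    obtain ⟨f', hf1, hf'⟩ := hfl.2
    obtain ⟨R', hR1, hR'⟩ := hRl.2
    obtain ⟨m', hm1, hm'⟩ := hml.2
    have hWl := ih hfl.of_succ hRl.of_succ hml.of_succ hm hW hWL
    refine ⟨hWL, ?_⟩
    have hf'q : ∀ b, ∀ x ∈ Icc 0 a, |f' b x| ≤ q := fun b x hx =>
      abs_deriv_le_of_lipschitz ha hx (hf1 b x hx) fun y hy => hfq b y hy x hx
    have hWF : SmoothFamily σ a l (fun b x => W (T b) (f b x)) :=
      hWl.comp hfl.of_succ hf hσ hκ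
    have hRt : SmoothFamily σ a l (fun b x => R' b x + m' b x * W (T b) (f b x)) :=
      hR'.add (hm'.mul hWF)
    have hmt : SmoothFamily σ a l (fun b x => m b x * f' b x) := hml.of_succ.mul hf'
    have hmq : ∀ b, ∀ x ∈ Icc 0 a, |m b x * f' b x| ≤ q := fun b x hx => by
      rw [abs_mul, ← one_mul q]
      exact mul_le_mul (hm b x hx) (hf'q b x hx) (abs_nonneg _) zero_le_one
    obtain ⟨MR, hMR0, hMR1, hMR2, hMR3⟩ := hRt.lip
    obtain ⟨Mm, hMm0, hMm1, hMm2, hMm3⟩ := hmt.lip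
    obtain ⟨Mf, hMf0, hMf1, hMf2, hMf3⟩ := hfl.lip
    obtain ⟨V', hV1, hV2⟩ := exists_bounded_solution (X := B × ℝ) (S := univ ×ˢ Icc 0 a)
      (F := fun p => (T p.1, f p.1 p.2)) (m := fun p => m p.1 p.2 * f' p.1 p.2)
      (R := fun p => R' p.1 p.2 + m' p.1 p.2 * W (T p.1) (f p.1 p.2)) (D := fun _ => MR) (θ := q)
      (by rintro ⟨b, x⟩ ⟨-, hx⟩; exact ⟨mem_univ _, hf b x hx⟩) hq0 hq
      (by rintro ⟨b, x⟩ ⟨-, hx⟩; exact hMR1 b x hx)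
      (by rintro ⟨b, x⟩ ⟨-, hx⟩; exact mul_le_mul_of_nonneg_right (hmq b x hx) hMR0)
    set V : B → ℝ → ℝ := fun b x => V' (b, x) with hVdef
    have hVeq : ∀ b, ∀ x ∈ Icc 0 a, V b x = (R' b x + m' b x * W (T b) (f b x)) +
      m b x * f' b x * V (T b) (f b x) := fun b x hx => hV1 (b, x) ⟨mem_univ _, hx⟩
    set N := (1 - q)⁻¹ * MR with hN
    have hN0 : 0 ≤ N := mul_nonneg (inv_nonneg.2 (sub_nonneg.2 hq.le)) hMR0
    have hVN : ∀ b, ∀ x ∈ Icc 0 a, |V b x| ≤ N := fun b x hx => hV2 (b, x) ⟨mem_univ _, hx⟩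
    have hVx := abs_solution_sub_le_fiber (C := MR + Mm * N) (D := fun _ => N) hq0 hq.le hq hq0 hq
      (by positivity) hf hfq hmq (fun _ _ _ => le_rfl) hVeq hVN
      (fun b x hx y hy => (hMR2 b x hx y hy).trans (by gcongr; nlinarith [mul_nonneg hMm0 hN0]))
      (fun b x hx y hy => by
        calc _ ≤ Mm * |x - y| * N := by
              gcongr
              · exact hMm2 b x hx y hy
              · exact hVN _ _ (hf b y hy)
          _ ≤ (MR + Mm * N) * |x - y| := by nlinarith [mul_nonneg hMR0 (abs_nonneg (x - y))])
    set L := (1 - q)⁻¹ * (2 * (MR + Mm * N)) with hLdef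
    have hL0 : 0 ≤ L := mul_nonneg (inv_nonneg.2 (sub_nonneg.2 hq.le)) (by positivity)
    have hVL : ∀ b, ∀ x ∈ Icc 0 a, ∀ y ∈ Icc 0 a, |V b x - V b y| ≤ L * |x - y| :=
      fun b x hx y hy => (hVx b x hx y hy).trans (le_of_eq (by rw [hLdef]; ring))
    have hVb := abs_solution_sub_le_base (σ := σ) (C := MR + Mm * N + Mf) (D := fun _ => N)
      (ω := fun _ => 1) (θ := q * κ) hq0 hq0 hq hqκ hL0 hf hmq
      (fun _ _ _ => le_rfl) (fun b b' x hx => by simpa using hσ b b') (fun b b' b'' x hx => by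
        have := mul_le_mul_of_nonneg_left (hκ b' b'') hq0
        linarith) hVeq hVN hVL
      (fun b b' x hx => (hMR3 b b' x hx).trans (by
        rw [one_mul]
        refine mul_le_mul_of_nonneg_right ?_ (hσ b b'); nlinarith [mul_nonneg hMm0 hN0]))
      (fun b b' x hx => (hMf3 b b' x hx).trans (by
        rw [one_mul]
        refine mul_le_mul_of_nonneg_right ?_ (hσ b b'); nlinarith [mul_nonneg hMm0 hN0]))
      (fun b b' x hx => by
        calc _ ≤ Mm * σ b b' * N := by
              refine mul_le_mul (hMm3 b b' x hx) (hVN _ _ (hf b' x hx)) (abs_nonneg _)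
                (mul_nonneg hMm0 (hσ b b'))
          _ ≤ _ := by nlinarith [mul_nonneg hMR0 (hσ b b'), mul_nonneg hMf0 (hσ b b')])
      (by positivity)
    have hVlip : LipFamily σ a V := by
      set P := (1 - q * κ)⁻¹ * (2 * (MR + Mm * N + Mf) + q * (L * (MR + Mm * N + Mf))) with hP
      refine ⟨max N (max L P), le_max_of_le_left hN0,
        fun b x hx => (hVN b x hx).trans (le_max_left _ _),
        fun b x hx y hy => (hVL b x hx y hy).trans ?_, fun b b' x hx => (hVb b b' x hx).trans ?_⟩
      · gcongr
        exact (le_max_left _ _).trans (le_max_right _ _)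
      · rw [one_mul, ← mul_assoc]
        exact mul_le_mul_of_nonneg_right ((le_max_right _ _).trans (le_max_right _ _)) (hσ b b')
    refine ⟨V, ?_, ih hfl.of_succ hRt hmt
      (fun b x hx => (hmq b x hx).trans hq.le) hVeq hVlip⟩
    obtain ⟨MW, hMW0, hMW1, hMW2, -⟩ := hWL
    obtain ⟨c1, h10, -, h12, -⟩ := hR'.lip
    obtain ⟨c2, h20, -, h22, -⟩ := hm'.lip
    obtain ⟨c3, h30, -, h32, -⟩ := hf'.lip
    obtain ⟨c4, h40, -, h42, -⟩ := hml.lip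
    refine hasDerivWithinAt_solution (L := MW + N) (C := c1 + c2 + c3 + c4) hq0 hq (by positivity)
      (by positivity) hf hfq hm hW hVeq (fun b x hx => (hMW1 b x hx).trans (by linarith))
      (fun b x hx y hy => (hMW2 b x hx y hy).trans (by gcongr; linarith))
      (fun b x hx => (hVN b x hx).trans (by linarith))
      (fun b x hx y hy => (abs_taylor_one_le h10 (hR1 b) (h12 b) hx hy).trans
        (by gcongr; linarith))
      (fun b x hx y hy => (abs_taylor_one_le h20 (hm1 b) (h22 b) hx hy).trans
        (by gcongr; linarith))
      (fun b x hx y hy => (abs_taylor_one_le h30 (hf1 b) (h32 b) hx hy).trans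
        (by gcongr; linarith))
      (fun b x hx y hy => (h42 b x hx y hy).trans (by gcongr; linarith))

end Solution

/-! ### Fiberwise linearization of contracting families -/

theorem abs_mul_exp_sub_sub_le {r : ℝ → ℝ} {c L x y : ℝ} (hL : 0 ≤ L) (hLc : L * c ≤ 1) (h0 : r 0 = 0)
    (hr : ∀ x ∈ Icc 0 c, ∀ y ∈ Icc 0 c, |r x - r y| ≤ L * |x - y|)
    (hx : x ∈ Icc 0 c) (hy : y ∈ Icc 0 c) :
    |x * Real.exp (r x) - y * Real.exp (r y) - (x - y)| ≤ 6 * (L * c) * |x - y| := by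
  have hc : (0 : ℝ) ≤ c := hx.1.trans hx.2
  have hb : ∀ z ∈ Icc 0 c, |r z| ≤ L * c := fun z hz => by
    have := hr z hz 0 ⟨le_rfl, hc⟩
    rw [h0, sub_zero, sub_zero, abs_of_nonneg hz.1] at this
    exact this.trans (by gcongr; exact hz.2)
  have h1 : ∀ z ∈ Icc 0 c, r z ≤ 1 := fun z hz => (le_abs_self _).trans ((hb z hz).trans hLc)
  have he : Real.exp 1 ≤ 3 := Real.exp_one_lt_three.le
  have h2 : |Real.exp (r x) - 1| ≤ 3 * (L * c) := by
    have := abs_exp_sub_exp_le (h1 x hx) zero_le_one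
    rw [Real.exp_zero, sub_zero] at this
    exact this.trans (by gcongr; exact hb x hx)
  have h3 : |Real.exp (r x) - Real.exp (r y)| ≤ 3 * (L * |x - y|) :=
    (abs_exp_sub_exp_le (h1 x hx) (h1 y hy)).trans (by gcongr; exact hr x hx y hy)
  have e : x * Real.exp (r x) - y * Real.exp (r y) - (x - y) =
      (x - y) * (Real.exp (r x) - 1) + y * (Real.exp (r x) - Real.exp (r y)) := by ring
  rw [e]
  refine (abs_add_le _ _).trans ?_
  rw [abs_mul, abs_mul, abs_of_nonneg hy.1]
  calc _ ≤ |x - y| * (3 * (L * c)) + c * (3 * (L * |x - y|)) := by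
        gcongr; exact hy.2
    _ = _ := by ring

theorem exists_fiber_rightInverse {B : Type*} {p : B → ℝ → ℝ} {c c₀ : ℝ} (hc : 0 < c)
    (h0 : ∀ b, p b 0 = 0) (hp : ∀ b, ContinuousOn (p b) (Icc 0 c))
    (hexp : ∀ b, ∀ x ∈ Icc 0 c, c₀ * x ≤ p b x) :
    ∃ g : B → ℝ → ℝ, ∀ b, ∀ y ∈ Icc 0 (c₀ * c), g b y ∈ Icc 0 c ∧ p b (g b y) = y := by
  have : ∀ b y, ∃ x, y ∈ Icc 0 (c₀ * c) → x ∈ Icc 0 c ∧ p b x = y := by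
    intro b y
    by_cases hy : y ∈ Icc 0 (c₀ * c)
    · have h1 : y ∈ Icc (p b 0) (p b c) := by
        rw [h0]
        exact ⟨hy.1, hy.2.trans (hexp b c ⟨hc.le, le_rfl⟩)⟩
      obtain ⟨x, hx, hxy⟩ := intermediate_value_Icc hc.le (hp b) h1
      exact ⟨x, fun _ => ⟨hx, hxy⟩⟩
    · exact ⟨0, fun h => absurd h hy⟩
  choose g hg using this
  exact ⟨g, hg⟩

/-- The datum of a family of fiber maps `x ↦ lam b * (x * exp (r b x))`, in the part that does not
involve the dependence on the parameter. -/
structure FiberData {B : Type*} (lam : B → ℝ) (r : B → ℝ → ℝ) (a L : ℝ) : Prop where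
  interval_pos : 0 < a
  nonneg : 0 ≤ L
  lam_pos : ∀ b, 0 < lam b
  map_zero : ∀ b, r b 0 = 0
  lipschitz : ∀ b, ∀ x ∈ Icc 0 a, ∀ y ∈ Icc 0 a, |r b x - r b y| ≤ L * |x - y|

/-- Regular dependence on the parameter of the fiber maps `x ↦ lam b * (x * exp (r b x))`. -/
structure RegularData {B : Type*} (σ : B → B → ℝ) (l : ℕ) (lam : B → ℝ) (r : B → ℝ → ℝ)
    (a : ℝ) : Prop where
  gauge_nonneg : ∀ b b', 0 ≤ σ b b'
  lam_holder : ∃ N, ∀ b b', |lam b - lam b'| ≤ N * σ b b'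
  smooth : SmoothFamily σ a l r
  weighted : WeightedFamily σ a r

section

variable {B : Type*} {lam : B → ℝ} {r : B → ℝ → ℝ} {a L : ℝ}

theorem FiberData.mono (h : FiberData lam r a L) {c : ℝ} (hc : 0 < c) (hca : c ≤ a) :
    FiberData lam r c L :=
  have hs : Icc 0 c ⊆ Icc 0 a := Icc_subset_Icc_right hca
  ⟨hc, h.nonneg, h.lam_pos, h.map_zero, fun b x hx y hy => h.lipschitz b x (hs hx) y (hs hy)⟩

theorem FiberData.continuousOn (h : FiberData lam r a L) (b : B) :
    ContinuousOn (fun x => x * Real.exp (r b x)) (Icc 0 a) := by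
  have : ContinuousOn (r b) (Icc 0 a) := by
    refine (LipschitzOnWith.of_dist_le_mul (K := L.toNNReal) fun x hx y hy => ?_).continuousOn
    rw [Real.dist_eq, Real.dist_eq, Real.coe_toNNReal _ h.nonneg]
    exact h.lipschitz b x hx y hy
  fun_prop

/-- On a short interval `x ↦ x * exp (r b x)` is close to the identity. -/
theorem FiberData.exists_near_id (h : FiberData lam r a L) {η : ℝ} (hη : 0 < η) :
    ∃ c, 0 < c ∧ c ≤ a ∧ ∀ b, ∀ x ∈ Icc 0 c, ∀ y ∈ Icc 0 c,
      |x * Real.exp (r b x) - y * Real.exp (r b y) - (x - y)| ≤ η * |x - y| := by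
  have hL := h.nonneg
  set c := min a (min 1 (η / 6) / (L + 1)) with hc
  have hc0 : 0 < c := lt_min h.interval_pos (by positivity)
  have hca : c ≤ a := min_le_left _ _
  have hLc : L * c ≤ min 1 (η / 6) := by
    have : (L + 1) * c ≤ min 1 (η / 6) := by
      rw [← le_div_iff₀' (by positivity)]; exact min_le_right _ _
    linarith
  refine ⟨c, hc0, hca, fun b x hx y hy => ?_⟩
  refine (abs_mul_exp_sub_sub_le hL (hLc.trans (min_le_left _ _)) (h.map_zero b)
    ((h.mono hc0 hca).lipschitz b) hx hy).trans ?_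
  gcongr
  linarith [hLc.trans (min_le_right _ _)]

theorem RegularData.smooth_fiberMap {σ : B → B → ℝ} {l : ℕ} {M : ℝ} (h : RegularData σ l lam r a)
    (hM : ∀ b, |lam b| ≤ M) :
    SmoothFamily σ a l (fun b x => lam b * Real.exp (r b x)) := by
  obtain ⟨N, hN⟩ := h.lam_holder
  exact (SmoothFamily.of_base h.gauge_nonneg hM hN).mul (h.smooth.exp h.gauge_nonneg)

/-- Fiberwise linearization of a family of contractions over an arbitrary base map. The interval and
the linearizing maps `H b` do not depend on the gauge in which the regularity is measured. -/
theorem exists_linearization (T : B → B) {q₀ q : ℝ} (h : FiberData lam r a L)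
    (hlam : ∀ b, lam b ≤ q₀) (hq₀ : q₀ < q) (hq : q < 1) (hq0 : 0 ≤ q) :
    ∃ (ε C : ℝ) (H : B → ℝ → ℝ), 0 < ε ∧ ε ≤ a ∧ 0 ≤ C ∧
      (∀ b, ∀ x ∈ Icc 0 ε, H b x ∈ Icc 0 a ∧ |H b x - x| ≤ C * x ^ 2) ∧
      (∀ b, ∀ x ∈ Icc 0 ε, lam b * (H b x * Real.exp (r b (H b x))) = H (T b) (lam b * x)) ∧
      (∀ b, ∀ y ∈ Icc 0 (ε / 2), ∃ x ∈ Icc 0 ε, H b x = y) ∧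
      (∀ b, ∀ x ∈ Icc 0 ε, ∀ y ∈ Icc 0 ε, |x - y| ≤ 2 * |H b x - H b y|) ∧
      ∀ (σ : B → B → ℝ) (κ : ℝ) (l : ℕ), RegularData σ l lam r a →
        (∀ b b', σ (T b) (T b') ≤ κ * σ b b') → q * κ < 1 → SmoothFamily σ ε l H := by
  have hL := h.nonneg
  have hlam0 := h.lam_pos
  have h1q : 0 < 1 - q := sub_pos.2 hq
  -- the interval `[0, c₁]` on which all fiber maps are `q`-contractions
  obtain ⟨c₁, hc₁, hc₁a, hnear⟩ := h.exists_near_id (sub_pos.2 hq₀)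
  have h1 := h.mono hc₁ hc₁a
  set f : B → ℝ → ℝ := fun b x => lam b * (x * Real.exp (r b x)) with hf
  have hfq : ∀ b, ∀ x ∈ Icc 0 c₁, ∀ y ∈ Icc 0 c₁, |f b x - f b y| ≤ q * |x - y| := by
    intro b x hx y hy
    have h2 := hnear b x hx y hy
    have h3 : |x * Real.exp (r b x) - y * Real.exp (r b y)| ≤ (1 + (q - q₀)) * |x - y| := by
      have := abs_add_le (x * Real.exp (r b x) - y * Real.exp (r b y) - (x - y)) (x - y)
      rw [sub_add_cancel] at this
      linarith
    have h4 : lam b * (1 + (q - q₀)) ≤ q := by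
      have := hlam b; have := hlam0 b
      nlinarith
    have e : f b x - f b y = lam b * (x * Real.exp (r b x) - y * Real.exp (r b y)) := by
      simp only [hf]; ring
    rw [e, abs_mul, abs_of_pos (hlam0 b)]
    calc _ ≤ lam b * ((1 + (q - q₀)) * |x - y|) := by have := hlam0 b; gcongr
      _ = (lam b * (1 + (q - q₀))) * |x - y| := by ring
      _ ≤ _ := by gcongr
  have hf0 : ∀ b, f b 0 = 0 := fun b => by simp [hf]
  have hfle : ∀ b, ∀ x ∈ Icc 0 c₁, 0 ≤ f b x ∧ f b x ≤ q * x := by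
    intro b x hx
    refine ⟨mul_nonneg (hlam0 b).le (mul_nonneg hx.1 (Real.exp_pos _).le), ?_⟩
    have := hfq b x hx 0 ⟨le_rfl, hc₁.le⟩
    rw [hf0, sub_zero, sub_zero, abs_of_nonneg hx.1] at this
    exact (le_abs_self _).trans this
  have hfx : ∀ b, ∀ x ∈ Icc 0 c₁, f b x ≤ x := fun b x hx =>
    (hfle b x hx).2.trans (mul_le_of_le_one_left hx.1 hq.le)
  have hfm : ∀ b, ∀ x ∈ Icc 0 c₁, f b x ∈ Icc 0 c₁ := fun b x hx =>
    ⟨(hfle b x hx).1, (hfx b x hx).trans hx.2⟩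
  -- the solution of the cohomological equation `w = r + w ∘ F`
  obtain ⟨w', hw1, hw2⟩ := exists_bounded_solution (X := B × ℝ) (S := univ ×ˢ Icc 0 c₁)
      (F := fun p => (T p.1, f p.1 p.2)) (m := fun p => 1) (R := fun p => r p.1 p.2)
      (D := fun p => L * p.2) (θ := q)
      (by rintro ⟨b, x⟩ ⟨-, hx⟩; exact ⟨mem_univ _, hfm b x hx⟩) hq0 hq
      (by
        rintro ⟨b, x⟩ ⟨-, hx⟩
        have := h1.lipschitz b x hx 0 ⟨le_rfl, hc₁.le⟩
        rwa [h.map_zero, sub_zero, sub_zero, abs_of_nonneg hx.1] at this)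
      (by
        rintro ⟨b, x⟩ ⟨-, hx⟩
        have := mul_le_mul_of_nonneg_left (hfle b x hx).2 hL
        dsimp only
        rw [abs_one]
        linarith)
  set w : B → ℝ → ℝ := fun b x => w' (b, x) with hw
  have hweq : ∀ b, ∀ x ∈ Icc 0 c₁, w b x = r b x + 1 * w (T b) (f b x) :=
    fun b x hx => hw1 (b, x) ⟨mem_univ _, hx⟩
  have hwD : ∀ b, ∀ x ∈ Icc 0 c₁, |w b x| ≤ (1 - q)⁻¹ * (L * x) :=
    fun b x hx => hw2 (b, x) ⟨mem_univ _, hx⟩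
  have hD : ∀ b, ∀ x ∈ Icc 0 c₁,
      1 * ((1 - q)⁻¹ * (L * f b x)) ≤ q * ((1 - q)⁻¹ * (L * x)) := by
    intro b x hx
    have := (hfle b x hx).2
    calc _ = (1 - q)⁻¹ * L * f b x := by ring
      _ ≤ (1 - q)⁻¹ * L * (q * x) := by gcongr
      _ = _ := by ring
  set Lw := (1 - q)⁻¹ * (2 * L) with hLw
  have hLw0 : 0 ≤ Lw := by positivity
  have hwL : ∀ b, ∀ x ∈ Icc 0 c₁, ∀ y ∈ Icc 0 c₁, |w b x - w b y| ≤ Lw * |x - y| := by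
    have := abs_solution_sub_le_fiber (m := fun _ _ => (1 : ℝ)) (W := w) (s := 1) (C := L)
      (D := fun x => (1 - q)⁻¹ * (L * x)) zero_le_one le_rfl hq hq0 hq hL hfm hfq (by simp) hD hweq
      hwD h1.lipschitz (fun b x hx y hy => by
        rw [sub_self, abs_zero, zero_mul]; positivity)
    exact fun b x hx y hy => (this b x hx y hy).trans (le_of_eq (by rw [hLw]; ring))
  have hw0 : ∀ b, w b 0 = 0 := fun b => by simpa using hwD b 0 ⟨le_rfl, hc₁.le⟩
  have hGd : FiberData (fun _ : B => (1 : ℝ)) w c₁ Lw := ⟨hc₁, hLw0, fun _ => one_pos, hw0, hwL⟩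
  -- the inverse of `G b x = x * exp (w b x)`
  obtain ⟨c₂, hc₂, hc₂₁, hGnear⟩ := hGd.exists_near_id (η := 1 / 2) (by norm_num)
  have hs : Icc 0 c₂ ⊆ Icc 0 c₁ := Icc_subset_Icc_right hc₂₁
  have h2 := hGd.mono hc₂ hc₂₁
  set G : B → ℝ → ℝ := fun b x => x * Real.exp (w b x) with hG
  have hGlow : ∀ b, ∀ x ∈ Icc 0 c₂, ∀ y ∈ Icc 0 c₂, 1 / 2 * |x - y| ≤ |G b x - G b y| := by
    intro b x hx y hy
    have h3 := hGnear b x hx y hy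
    have h4 := abs_sub_abs_le_abs_sub (x - y) (G b x - G b y)
    rw [abs_sub_comm (x - y) (G b x - G b y)] at h4
    simp only [hG] at h4 ⊢
    linarith
  have hGup : ∀ b, ∀ x ∈ Icc 0 c₂, ∀ y ∈ Icc 0 c₂, |G b x - G b y| ≤ 2 * |x - y| := by
    intro b x hx y hy
    have h3 := hGnear b x hx y hy
    have h4 := abs_sub_abs_le_abs_sub (G b x - G b y) (x - y)
    have := abs_nonneg (x - y)
    simp only [hG] at h4 ⊢
    linarith
  have hG0 : ∀ b, G b 0 = 0 := fun b => by simp [hG]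
  have hGnn : ∀ b, ∀ x ∈ Icc 0 c₂, 0 ≤ G b x := fun b x hx => mul_nonneg hx.1 (Real.exp_pos _).le
  have hGx : ∀ b, ∀ x ∈ Icc 0 c₂, 1 / 2 * x ≤ G b x ∧ G b x ≤ 2 * x := by
    intro b x hx
    have h3 := hGlow b x hx 0 ⟨le_rfl, hc₂.le⟩
    have h4 := hGup b x hx 0 ⟨le_rfl, hc₂.le⟩
    rw [hG0, sub_zero, sub_zero, abs_of_nonneg hx.1, abs_of_nonneg (hGnn b x hx)] at h3 h4
    exact ⟨h3, h4⟩
  have hGinj : ∀ b, ∀ x ∈ Icc 0 c₂, ∀ y ∈ Icc 0 c₂, G b x = G b y → x = y := by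
    intro b x hx y hy hxy
    have := hGlow b x hx y hy
    rw [hxy, sub_self, abs_zero] at this
    have := abs_nonneg (x - y)
    exact sub_eq_zero.1 (abs_eq_zero.1 (by linarith))
  obtain ⟨H, hH⟩ := exists_fiber_rightInverse hc₂ hG0 h2.continuousOn (fun b x hx => (hGx b x hx).1)
  refine ⟨1 / 2 * c₂, 4 * Real.exp (Lw * c₂) * Lw, H, by positivity, by linarith, by positivity, ?_, ?_, ?_, ?_, ?_⟩
  · intro b x hx
    obtain ⟨hm, he⟩ := hH b x hx
    refine ⟨⟨hm.1, hm.2.trans (hc₂₁.trans hc₁a)⟩, ?_⟩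
    have hHx : H b x ≤ 2 * x := by
      have := (hGx b _ hm).1
      rw [he] at this
      linarith
    have hwle : |w b (H b x)| ≤ Lw * H b x := by
      have := hwL b _ (hs hm) 0 ⟨le_rfl, hc₁.le⟩
      rwa [hw0, sub_zero, sub_zero, abs_of_nonneg hm.1] at this
    have hwc : |w b (H b x)| ≤ Lw * c₂ := hwle.trans (by gcongr; exact hm.2)
    have h5 := abs_exp_sub_exp_le ((le_abs_self _).trans hwc) (t := 0) (by positivity)
    rw [Real.exp_zero, sub_zero] at h5
    have e : H b x - x = -(H b x * (Real.exp (w b (H b x)) - 1)) := by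
      nth_rw 2 [← he]
      simp only [hG]; ring
    rw [e, abs_neg, abs_mul, abs_of_nonneg hm.1]
    have hm1 := hm.1
    calc _ ≤ H b x * (Real.exp (Lw * c₂) * (Lw * H b x)) := by
          gcongr; exact h5.trans (by gcongr)
      _ ≤ 2 * x * (Real.exp (Lw * c₂) * (Lw * (2 * x))) := by gcongr; linarith [hx.1]
      _ = _ := by ring
  · intro b x hx
    obtain ⟨hm, he⟩ := hH b x hx
    have hlx : lam b * x ∈ Icc 0 (1 / 2 * c₂) :=
      ⟨mul_nonneg (hlam0 b).le hx.1, (mul_le_of_le_one_left hx.1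
        (by linarith [hlam b])).trans hx.2⟩
    obtain ⟨hm', he'⟩ := hH (T b) _ hlx
    have hfc : f b (H b x) ∈ Icc 0 c₂ :=
      ⟨(hfle b _ (hs hm)).1, (hfx b _ (hs hm)).trans hm.2⟩
    refine hGinj (T b) _ hfc _ hm' ?_
    rw [he']
    have h5 := hweq b _ (hs hm)
    rw [one_mul] at h5
    calc G (T b) (f b (H b x))
        = lam b * (H b x * (Real.exp (r b (H b x)) * Real.exp (w (T b) (f b (H b x))))) := by
          simp only [hG, hf]; ring
      _ = lam b * G b (H b x) := by rw [← Real.exp_add, ← h5]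
      _ = lam b * x := by rw [he]
  · intro b y hy
    have hy' : y ∈ Icc 0 c₂ := ⟨hy.1, hy.2.trans (by linarith)⟩
    have hx : G b y ∈ Icc 0 (1 / 2 * c₂) := ⟨hGnn b y hy', by
      have := (hGx b y hy').2
      linarith [hy.2]⟩
    obtain ⟨hm, he⟩ := hH b _ hx
    exact ⟨G b y, hx, hGinj b _ hm _ hy' he⟩
  · intro b x hx y hy
    obtain ⟨hm, he⟩ := hH b x hx
    obtain ⟨hm', he'⟩ := hH b y hy
    have := hGup b _ hm _ hm'
    rwa [he, he'] at this
  · intro σ κ l hreg hκ hqκ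
    have hσ := hreg.gauge_nonneg
    have hu : SmoothFamily σ c₁ l (fun b x => lam b * Real.exp (r b x)) :=
      (hreg.smooth_fiberMap (M := 1) fun b => by
        rw [abs_of_pos (hlam0 b)]; linarith [hlam b]).mono_interval hc₁a
    have hfl : SmoothFamily σ c₁ l f :=
      ((SmoothFamily.id hσ).mul hu).congr fun b x _ => by simp only [hf]; ring
    have hwlip : LipFamily σ c₁ w := by
      obtain ⟨Mr, hMr0, -, hMr⟩ := hreg.weighted.mono_interval hc₁a
      obtain ⟨Mu, hMu0, -, -, hMu⟩ := hu.lip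
      have hwb := abs_solution_sub_le_base (σ := σ) (m := fun _ _ => (1 : ℝ)) (W := w) (s := 1)
        (C := Mr + Mu) (D := fun x => (1 - q)⁻¹ * (L * x)) (ω := fun x => x) (θ := q * κ)
        zero_le_one hq0 hq hqκ hLw0 hfm (by simp) hD
        (fun b b' x hx => mul_nonneg hx.1 (hσ b b'))
        (fun b b' b'' x hx => by
          have hκσ : 0 ≤ κ * σ b' b'' := (hσ _ _).trans (hκ b' b'')
          have := (hfle b x hx)
          calc 1 * (f b x * σ (T b') (T b'')) ≤ 1 * (f b x * (κ * σ b' b'')) := by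
                gcongr
                · exact this.1
                · exact hκ _ _
            _ ≤ 1 * (q * x * (κ * σ b' b'')) := by gcongr; exact this.2
            _ = _ := by ring)
        hweq hwD hwL
        (fun b b' x hx => (hMr b b' x hx).trans (by
          have := mul_nonneg hx.1 (hσ b b'); gcongr; linarith))
        (fun b b' x hx => by
          have e : f b x - f b' x =
              x * (lam b * Real.exp (r b x) - lam b' * Real.exp (r b' x)) := by
            simp only [hf]; ring
          rw [e, abs_mul, abs_of_nonneg hx.1]
          calc _ ≤ x * (Mu * σ b b') := mul_le_mul_of_nonneg_left (hMu b b' x hx) hx.1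
            _ = Mu * (x * σ b b') := by ring
            _ ≤ _ := by have := mul_nonneg hx.1 (hσ b b'); gcongr; linarith)
        (fun b b' x hx => by
          have := mul_nonneg hx.1 (hσ b b')
          rw [sub_self, abs_zero, zero_mul]; positivity) (by positivity)
      set P := (1 - q * κ)⁻¹ * (2 * (Mr + Mu) + 1 * (Lw * (Mr + Mu))) with hP
      have hP0 : 0 ≤ P := mul_nonneg (inv_nonneg.2 (sub_pos.2 hqκ).le) (by positivity)
      refine ⟨max ((1 - q)⁻¹ * (L * c₁)) (max Lw (P * c₁)), by positivity, fun b x hx => ?_,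
        fun b x hx y hy => (hwL b x hx y hy).trans ?_, fun b b' x hx => ?_⟩
      · refine (hwD b x hx).trans (le_trans ?_ (le_max_left _ _))
        gcongr
        exact hx.2
      · gcongr
        exact (le_max_left _ _).trans (le_max_right _ _)
      · have h6 := hσ b b'
        calc _ ≤ P * x * σ b b' := (hwb b b' x hx).trans (le_of_eq (by rw [hP]; ring))
          _ ≤ P * c₁ * σ b b' := by gcongr; exact hx.2
          _ ≤ _ := by gcongr; exact (le_max_right _ _).trans (le_max_right _ _)
    have hwl : SmoothFamily σ c₁ l w :=
      SmoothFamily.solution hc₁ hσ hκ hq0 hq hqκ hfm hfq hfl (hreg.smooth.mono_interval hc₁a)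
        (SmoothFamily.const hσ 1) (by simp) hweq hwlip
    have hGl : SmoothFamily σ c₂ l G :=
      ((SmoothFamily.id hσ).mul (hwl.exp hσ)).mono_interval hc₂₁
    exact hGl.rightInverse hc₂ hσ (by norm_num) hGlow (fun b y hy => (hH b y hy).1)
      (fun b y hy => (hH b y hy).2)

/-- The fiberwise inverse of a family of fiber maps is a family of the same form. -/
theorem exists_inverse_fiberData {c C : ℝ} (h : FiberData lam r a L) (hc : 0 < c)
    (hlamc : ∀ b, c ≤ lam b) (hlamC : ∀ b, lam b ≤ C) :
    ∃ (ε L' : ℝ) (g : B → ℝ → ℝ), ε ≤ a ∧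
      FiberData (fun b => (lam b)⁻¹) (fun b y => -r b (g b y)) ε L' ∧
      (∀ b, ∀ y ∈ Icc 0 ε, g b y ∈ Icc 0 a ∧ lam b * (g b y * Real.exp (r b (g b y))) = y) ∧
      ∀ (σ : B → B → ℝ) (l : ℕ), RegularData σ l lam r a →
        RegularData σ l (fun b => (lam b)⁻¹) (fun b y => -r b (g b y)) ε := by
  have hL := h.nonneg
  have hlam0 := h.lam_pos
  obtain ⟨c₁, hc₁, hc₁a, hnear⟩ := h.exists_near_id (η := 1 / 2) (by norm_num)
  have h1 := h.mono hc₁ hc₁a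
  set p : B → ℝ → ℝ := fun b x => lam b * (x * Real.exp (r b x)) with hp
  have hlow : ∀ b, ∀ x ∈ Icc 0 c₁, ∀ y ∈ Icc 0 c₁, c / 2 * |x - y| ≤ |p b x - p b y| := by
    intro b x hx y hy
    have h3 := hnear b x hx y hy
    have h4 := abs_sub_abs_le_abs_sub (x - y) (x * Real.exp (r b x) - y * Real.exp (r b y))
    rw [abs_sub_comm (x - y) _] at h4
    have e : p b x - p b y = lam b * (x * Real.exp (r b x) - y * Real.exp (r b y)) := by
      simp only [hp]; ring
    rw [e, abs_mul, abs_of_pos (hlam0 b)]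
    calc c / 2 * |x - y| = c * (1 / 2 * |x - y|) := by ring
      _ ≤ _ := by
        have := hlamc b
        have := hlam0 b
        gcongr
        linarith
  have hp0 : ∀ b, p b 0 = 0 := fun b => by simp [hp]
  have hpnn : ∀ b, ∀ x ∈ Icc 0 c₁, 0 ≤ p b x := fun b x hx =>
    mul_nonneg (hlam0 b).le (mul_nonneg hx.1 (Real.exp_pos _).le)
  have hplow : ∀ b, ∀ x ∈ Icc 0 c₁, c / 2 * x ≤ p b x := by
    intro b x hx
    have h3 := hlow b x hx 0 ⟨le_rfl, hc₁.le⟩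
    rwa [hp0, sub_zero, sub_zero, abs_of_nonneg hx.1, abs_of_nonneg (hpnn b x hx)] at h3
  obtain ⟨g, hg⟩ := exists_fiber_rightInverse hc₁ hp0
    (fun b => (h1.continuousOn b).const_smul (lam b)) hplow
  set ε := min a (c / 2 * c₁) with hε
  have hε0 : 0 < ε := lt_min h.interval_pos (by positivity)
  have hsε : Icc 0 ε ⊆ Icc 0 (c / 2 * c₁) := Icc_subset_Icc_right (min_le_right _ _)
  have hgm : ∀ b, ∀ y ∈ Icc 0 ε, g b y ∈ Icc 0 c₁ := fun b y hy => (hg b y (hsε hy)).1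
  have hgp : ∀ b, ∀ y ∈ Icc 0 ε, p b (g b y) = y := fun b y hy => (hg b y (hsε hy)).2
  have hglip : ∀ b, ∀ x ∈ Icc 0 ε, ∀ y ∈ Icc 0 ε, |g b x - g b y| ≤ (c / 2)⁻¹ * |x - y| := by
    intro b x hx y hy
    have := hlow b _ (hgm b x hx) _ (hgm b y hy)
    rw [hgp b x hx, hgp b y hy] at this
    rwa [inv_mul_eq_div, le_div_iff₀' (by positivity)]
  have hgle : ∀ b, ∀ y ∈ Icc 0 ε, g b y ≤ (c / 2)⁻¹ * y := by
    intro b y hy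
    have := hplow b _ (hgm b y hy)
    rw [hgp b y hy] at this
    rwa [inv_mul_eq_div, le_div_iff₀' (by positivity)]
  have hg0 : ∀ b, g b 0 = 0 := fun b => le_antisymm
    (by simpa using hgle b 0 ⟨le_rfl, hε0.le⟩) (hgm b 0 ⟨le_rfl, hε0.le⟩).1
  refine ⟨ε, L * (c / 2)⁻¹, g, min_le_left _ _, ⟨hε0, by positivity, fun b => inv_pos.2 (hlam0 b),
    fun b => by simp [hg0, h.map_zero], fun b x hx y hy => ?_⟩, fun b y hy =>
    ⟨⟨(hgm b y hy).1, (hgm b y hy).2.trans hc₁a⟩, hgp b y hy⟩, fun σ l hreg => ?_⟩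
  · rw [neg_sub_neg, abs_sub_comm, mul_assoc]
    refine (h1.lipschitz b _ (hgm b x hx) _ (hgm b y hy)).trans ?_
    gcongr
    exact hglip b x hx y hy
  · have hσ := hreg.gauge_nonneg
    have hu : SmoothFamily σ c₁ l (fun b x => lam b * Real.exp (r b x)) :=
      (hreg.smooth_fiberMap (M := C) fun b => by
        rw [abs_of_pos (hlam0 b)]; exact hlamC b).mono_interval hc₁a
    have hpl : SmoothFamily σ c₁ l p :=
      ((SmoothFamily.id hσ).mul hu).congr fun b x _ => by simp only [hp]; ring
    have hgl : SmoothFamily σ ε l g := hpl.rightInverse hc₁ hσ (half_pos hc) hlow hgm hgp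
    have hgw : ∃ N, 0 ≤ N ∧ ∀ b b', ∀ y ∈ Icc 0 ε, |g b y - g b' y| ≤ N * (y * σ b b') := by
      obtain ⟨Mu, hMu0, -, -, hMu⟩ := hu.lip
      refine ⟨(c / 2)⁻¹ * (Mu * (c / 2)⁻¹), by positivity, fun b b' y hy => ?_⟩
      have h3 := hlow b _ (hgm b y hy) _ (hgm b' y hy)
      have h4 : p b (g b y) - p b (g b' y) = g b' y * (lam b' * Real.exp (r b' (g b' y)) -
          lam b * Real.exp (r b (g b' y))) := by
        rw [hgp b y hy]
        nth_rw 1 [← hgp b' y hy]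
        simp only [hp]; ring
      rw [h4, abs_mul, abs_of_nonneg (hgm b' y hy).1, abs_sub_comm (lam b' * _)] at h3
      have h5 : |g b y - g b' y| ≤ (c / 2)⁻¹ * (g b' y * (Mu * σ b b')) := by
        rw [inv_mul_eq_div, le_div_iff₀' (by positivity)]
        refine h3.trans (mul_le_mul_of_nonneg_left (hMu b b' _ (hgm b' y hy)) (hgm b' y hy).1)
      refine h5.trans ?_
      have h6 := hσ b b'
      calc _ ≤ (c / 2)⁻¹ * ((c / 2)⁻¹ * y * (Mu * σ b b')) := by gcongr; exact hgle b' y hy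
        _ = _ := by ring
    refine ⟨hσ, ?_, ?_, ?_⟩
    · obtain ⟨N, hN⟩ := hreg.lam_holder
      refine ⟨c⁻¹ * c⁻¹ * N, fun b b' => ?_⟩
      refine (abs_inv_sub_inv_le hc ((hlamc b).trans (le_abs_self _))
        ((hlamc b').trans (le_abs_self _))).trans ?_
      rw [mul_assoc _ N]
      gcongr
      exact hN b b'
    · exact ((hreg.smooth.mono_interval hc₁a).comp (τ := fun b => b) (K := 1) hgl hgm hσ
        (fun b b' => by simp)).neg
    · obtain ⟨M, hM0, hM1, hM2⟩ := hreg.weighted.mono_interval hc₁a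
      obtain ⟨N, hN0, hN⟩ := hgw
      refine ⟨max (M * (c / 2)⁻¹) (M * N + M * (c / 2)⁻¹), by positivity, fun b x hx y hy => ?_,
        fun b b' y hy => ?_⟩
      · rw [neg_sub_neg, abs_sub_comm]
        calc _ ≤ M * ((c / 2)⁻¹ * |x - y|) := (hM1 b _ (hgm b x hx) _ (hgm b y hy)).trans
              (mul_le_mul_of_nonneg_left (hglip b x hx y hy) hM0)
          _ = M * (c / 2)⁻¹ * |x - y| := by ring
          _ ≤ _ := by gcongr; exact le_max_left _ _
      · rw [neg_sub_neg, abs_sub_comm]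
        have h6 := hσ b b'
        have h7 := mul_nonneg hy.1 h6
        calc _ ≤ |r b (g b y) - r b (g b' y)| + |r b (g b' y) - r b' (g b' y)| := abs_sub_le _ _ _
          _ ≤ M * (N * (y * σ b b')) + M * ((c / 2)⁻¹ * y * σ b b') := by
            gcongr
            · refine (hM1 b _ (hgm b y hy) _ (hgm b' y hy)).trans ?_
              gcongr
              exact hN b b' y hy
            · refine (hM2 b b' _ (hgm b' y hy)).trans ?_
              gcongr
              exact hgle b' y hy
          _ = (M * N + M * (c / 2)⁻¹) * (y * σ b b') := by ring
          _ ≤ _ := by gcongr; exact le_max_right _ _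

end

/-! ### Families of `C^k` functions and division by the fiber variable -/

/-- A family of `C^k` functions on `[0, a]` with derivatives bounded and dependent on the parameter
in a Lipschitz way with respect to the gauge `σ`. Unlike for `SmoothFamily`, the derivative of order
`k` is not required to be Lipschitz in the fiber variable. -/
def CkFamily {B : Type*} (σ : B → B → ℝ) (a : ℝ) (k : ℕ) (g : B → ℝ → ℝ) : Prop :=
  (∀ b, ContDiffOn ℝ k (g b) (Icc 0 a)) ∧ ∃ M : ℝ, 0 ≤ M ∧
    (∀ b, ∀ j ≤ k, ∀ x ∈ Icc 0 a, |iteratedDerivWithin j (g b) (Icc 0 a) x| ≤ M) ∧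
    (∀ b b', ∀ j ≤ k, ∀ x ∈ Icc 0 a,
      |iteratedDerivWithin j (g b - g b') (Icc 0 a) x| ≤ M * σ b b')

/-- The average `∫₀¹ t ^ j * p b (t * x) dt` along the segment from `0` to `x`. -/
noncomputable def radialAverage {B : Type*} (j : ℕ) (p : B → ℝ → ℝ) (b : B) (x : ℝ) : ℝ :=
  ∫ t in (0 : ℝ)..1, t ^ j * p b (t * x)

section

variable {B : Type*} {σ : B → B → ℝ} {a : ℝ} {l k : ℕ} {g p : B → ℝ → ℝ}

theorem CkFamily.hasDerivWithinAt (hg : CkFamily σ a (k + 1) g) (b : B) {x : ℝ}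
    (hx : x ∈ Icc 0 a) :
    HasDerivWithinAt (g b) (derivWithin (g b) (Icc 0 a) x) (Icc 0 a) x :=
  (((hg.1 b).differentiableOn (by simp)) x hx).hasDerivWithinAt

theorem CkFamily.derivWithin (ha : 0 < a) (hg : CkFamily σ a (k + 1) g) :
    CkFamily σ a k (fun b => derivWithin (g b) (Icc 0 a)) := by
  have hu := uniqueDiffOn_Icc ha
  obtain ⟨h1, M, hM0, hM1, hM2⟩ := id hg
  refine ⟨fun b => ((contDiffOn_succ_iff_derivWithin hu).1 (by exact_mod_cast h1 b)).2.2,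
    M, hM0, fun b j hj x hx => ?_, fun b b' j hj x hx => ?_⟩
  · rw [← iteratedDerivWithin_succ']
    exact hM1 b (j + 1) (by omega) x hx
  · have := hM2 b b' (j + 1) (by omega) x hx
    rw [iteratedDerivWithin_succ'] at this
    convert this using 2
    refine iteratedDerivWithin_congr (fun y hy => ?_) hx
    exact (((hg.hasDerivWithinAt b hy).sub (hg.hasDerivWithinAt b' hy)).derivWithin (hu y hy)).symm

theorem CkFamily.of_succ (hg : CkFamily σ a (k + 1) g) : CkFamily σ a k g := by
  obtain ⟨h1, M, hM0, hM1, hM2⟩ := hg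
  exact ⟨fun b => (h1 b).of_le (by exact_mod_cast k.le_succ), M, hM0,
    fun b j hj => hM1 b j (by omega), fun b b' j hj => hM2 b b' j (by omega)⟩

theorem CkFamily.smoothFamily (ha : 0 < a) (hg : CkFamily σ a (l + 1) g) :
    SmoothFamily σ a l g := by
  induction l generalizing g with
  | zero =>
    obtain ⟨h1, M, hM0, hM1, hM2⟩ := id hg
    refine ⟨M, hM0, fun b x hx => ?_, fun b x hx y hy => ?_, fun b b' x hx => ?_⟩
    · simpa using hM1 b 0 (by omega) x hx
    · refine abs_sub_le_of_hasDerivWithinAt (fun z hz => hg.hasDerivWithinAt b hz)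
        (fun z hz => ?_) hy hx
      have := hM1 b 1 le_rfl z hz
      rwa [iteratedDerivWithin_one] at this
    · simpa using hM2 b b' 0 (by omega) x hx
  | succ l ih =>
    exact ⟨(ih hg.of_succ).lip, _, fun b x hx => hg.hasDerivWithinAt b hx, ih (hg.derivWithin ha)⟩

/-- The mixed difference of a `C¹` family. -/
theorem CkFamily.exists_mixed_bound (ha : 0 < a) (hg : CkFamily σ a 1 g) :
    ∃ M, 0 ≤ M ∧ ∀ b b', ∀ x ∈ Icc 0 a,
      |g b x - g b 0 - (g b' x - g b' 0)| ≤ M * σ b b' * x := by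
  obtain ⟨-, M, hM0, hM1, hM2⟩ := id hg
  refine ⟨M, hM0, fun b b' x hx => ?_⟩
  have := abs_sub_le_of_hasDerivWithinAt (g := g b - g b') (M := M * σ b b')
    (fun z hz => (hg.hasDerivWithinAt (k := 0) b hz).sub (hg.hasDerivWithinAt (k := 0) b' hz))
    (fun z hz => ?_) ⟨le_rfl, ha.le⟩ hx
  · rw [sub_zero, abs_of_nonneg hx.1] at this
    convert this using 2
    simp only [Pi.sub_apply]; ring
  · have := hM2 b b' 1 le_rfl z hz
    rw [iteratedDerivWithin_one] at this
    rwa [((hg.hasDerivWithinAt (k := 0) b hz).sub (hg.hasDerivWithinAt (k := 0) b' hz)).derivWithin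
      (uniqueDiffOn_Icc ha z hz)] at this

theorem LipFamily.continuousOn (hp : LipFamily σ a p) (b : B) : ContinuousOn (p b) (Icc 0 a) := by
  obtain ⟨M, hM0, -, hM, -⟩ := hp
  refine (LipschitzOnWith.of_dist_le_mul (K := M.toNNReal) fun x hx y hy => ?_).continuousOn
  rw [Real.dist_eq, Real.dist_eq, Real.coe_toNNReal _ hM0]
  exact hM b x hx y hy

theorem mul_mem_Icc_of_mem_unit {t x : ℝ} (ht : t ∈ Icc (0 : ℝ) 1) (hx : x ∈ Icc 0 a) :
    t * x ∈ Icc 0 a :=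
  ⟨mul_nonneg ht.1 hx.1, (mul_le_of_le_one_left hx.1 ht.2).trans hx.2⟩

theorem intervalIntegrable_radial (hp : LipFamily σ a p) (j : ℕ) (b : B) {x : ℝ}
    (hx : x ∈ Icc 0 a) :
    IntervalIntegrable (fun t => t ^ j * p b (t * x)) MeasureTheory.volume 0 1 := by
  refine ContinuousOn.intervalIntegrable ?_
  rw [uIcc_of_le zero_le_one]
  refine (continuous_pow j).continuousOn.mul ((hp.continuousOn b).comp (by fun_prop) ?_)
  exact fun t ht => mul_mem_Icc_of_mem_unit ht hx

theorem abs_integral_unit_le {u : ℝ → ℝ} {C : ℝ} (h : ∀ t ∈ Icc (0 : ℝ) 1, |u t| ≤ C) :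
    |∫ t in (0 : ℝ)..1, u t| ≤ C := by
  have := intervalIntegral.norm_integral_le_of_norm_le_const (a := (0 : ℝ)) (b := 1) (f := u)
    (C := C) (fun t ht => h t (by
      rw [uIoc_of_le zero_le_one] at ht; exact ⟨ht.1.le, ht.2⟩))
  simpa using this

theorem abs_pow_mul_le {t u C : ℝ} {j : ℕ} (ht : t ∈ Icc (0 : ℝ) 1) (hu : |u| ≤ C) :
    |t ^ j * u| ≤ C := by
  rw [abs_mul, abs_of_nonneg (pow_nonneg ht.1 j)]
  exact (mul_le_of_le_one_left (abs_nonneg _) (pow_le_one₀ ht.1 ht.2)).trans hu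

theorem LipFamily.radialAverage (hp : LipFamily σ a p) (j : ℕ) :
    LipFamily σ a (radialAverage j p) := by
  have hi := fun b {x} hx => intervalIntegrable_radial hp j b (x := x) hx
  obtain ⟨M, hM0, hM1, hM2, hM3⟩ := hp
  refine ⟨M, hM0, fun b x hx => ?_, fun b x hx y hy => ?_, fun b b' x hx => ?_⟩
  · exact abs_integral_unit_le fun t ht =>
      abs_pow_mul_le ht (hM1 b _ (mul_mem_Icc_of_mem_unit ht hx))
  · unfold _root_.radialAverage
    rw [← intervalIntegral.integral_sub (hi b hx) (hi b hy)]
    refine abs_integral_unit_le fun t ht => ?_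
    rw [← mul_sub]
    refine abs_pow_mul_le ht ((hM2 b _ (mul_mem_Icc_of_mem_unit ht hx) _
      (mul_mem_Icc_of_mem_unit ht hy)).trans ?_)
    rw [← mul_sub, abs_mul, abs_of_nonneg ht.1]
    gcongr
    exact mul_le_of_le_one_left (abs_nonneg _) ht.2
  · unfold _root_.radialAverage
    rw [← intervalIntegral.integral_sub (hi b hx) (hi b' hx)]
    refine abs_integral_unit_le fun t ht => ?_
    rw [← mul_sub]
    exact abs_pow_mul_le ht (hM3 b b' _ (mul_mem_Icc_of_mem_unit ht hx))

theorem SmoothFamily.radialAverage (hp : SmoothFamily σ a l p) (j : ℕ) :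
    SmoothFamily σ a l (radialAverage j p) := by
  induction l generalizing j p with
  | zero => exact LipFamily.radialAverage hp j
  | succ l ih =>
    obtain ⟨p', h1, h2⟩ := hp.2
    refine ⟨hp.1.radialAverage j, _, fun b x hx => ?_, ih h2 (j + 1)⟩
    obtain ⟨M, hM0, -, hM2, -⟩ := h2.lip
    refine hasDerivWithinAt_of_quadratic_bound (M := M) fun y hy => ?_
    have hi := fun {x} hx => intervalIntegrable_radial hp.1 j b (x := x) hx
    have hi' := intervalIntegrable_radial h2.lip (j + 1) b hx
    unfold _root_.radialAverage
    rw [← intervalIntegral.integral_sub (hi hy) (hi hx), ← intervalIntegral.integral_mul_const,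
      ← intervalIntegral.integral_sub ((hi hy).sub (hi hx)) (hi'.mul_const _)]
    refine abs_integral_unit_le fun t ht => ?_
    have e : t ^ j * p b (t * y) - t ^ j * p b (t * x) - t ^ (j + 1) * p' b (t * x) * (y - x) =
        t ^ j * (p b (t * y) - p b (t * x) - p' b (t * x) * (t * y - t * x)) := by ring
    rw [e]
    refine abs_pow_mul_le ht ((abs_taylor_one_le hM0 (h1 b) (hM2 b)
      (mul_mem_Icc_of_mem_unit ht hx) (mul_mem_Icc_of_mem_unit ht hy)).trans ?_)
    rw [← mul_sub, abs_mul, abs_of_nonneg ht.1]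
    have := ht.1
    gcongr
    exact mul_le_of_le_one_left (abs_nonneg _) ht.2

theorem radialAverage_zero (p : B → ℝ → ℝ) (b : B) : radialAverage 0 p b 0 = p b 0 := by
  simp [radialAverage]

/-- A function vanishing at `0` is `x` times the radial average of its derivative. -/
theorem eq_mul_radialAverage (hp : LipFamily σ a p) {b : B} (h0 : g b 0 = 0)
    (hg : ∀ x ∈ Icc 0 a, HasDerivWithinAt (g b) (p b x) (Icc 0 a) x) {x : ℝ} (hx : x ∈ Icc 0 a) :
    g b x = x * radialAverage 0 p b x := by
  rcases hx.1.eq_or_lt with rfl | hx0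
  · simp [h0]
  have hi := (intervalIntegrable_radial hp 0 b hx).const_mul x
  have hcont : ContinuousOn (fun t => g b (t * x)) (Icc 0 1) :=
    ContinuousOn.comp (t := Icc 0 a) (fun y hy => (hg y hy).continuousWithinAt) (by fun_prop)
      (fun t ht => mul_mem_Icc_of_mem_unit ht hx)
  have hderiv : ∀ t ∈ Ioo (0 : ℝ) 1,
      HasDerivAt (fun t => g b (t * x)) (x * (t ^ 0 * p b (t * x))) t := by
    intro t ht
    have hin : t * x ∈ Ioo 0 a :=
      ⟨mul_pos ht.1 hx0, (mul_lt_of_lt_one_left hx0 ht.2).trans_le hx.2⟩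
    have h1 := (hg (t * x) (Ioo_subset_Icc_self hin)).hasDerivAt (Icc_mem_nhds hin.1 hin.2)
    have h2 : HasDerivAt (fun t : ℝ => t * x) x t := by simpa using (hasDerivAt_id t).mul_const x
    refine (h1.comp t h2).congr_deriv ?_
    simp [mul_comm]
  have := intervalIntegral.integral_eq_sub_of_hasDerivAt_of_le zero_le_one hcont hderiv hi
  rw [intervalIntegral.integral_const_mul] at this
  rw [radialAverage, this]
  simp [h0]

/-- Fiber maps of class `C^{l+2}` have the form `x ↦ lam b * (x * exp (r b x))` near `0`, with `r` of
class `C^l` and Lipschitz derivatives; the interval and the function `r` do not depend on the gauge. -/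
theorem exists_fiberData {lam : B → ℝ} {c : ℝ} (ha : 0 < a) (hc : 0 < c)
    (h0 : ∀ b, g b 0 = 0) (hlam : ∀ b, lam b = derivWithin (g b) (Icc 0 a) 0)
    (hlamc : ∀ b, c ≤ lam b) (hbdd : CkFamily (fun _ _ => (1 : ℝ)) a 2 g) :
    ∃ (c₁ L : ℝ) (r : B → ℝ → ℝ), c₁ ≤ a ∧ FiberData lam r c₁ L ∧
      (∀ b, ∀ x ∈ Icc 0 c₁, g b x = lam b * (x * Real.exp (r b x))) ∧
      ∀ (σ : B → B → ℝ) (l : ℕ), (∀ b b', 0 ≤ σ b b') → CkFamily σ a (l + 2) g →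
        RegularData σ l lam r c₁ := by
  set p : B → ℝ → ℝ := fun b => derivWithin (g b) (Icc 0 a) with hp
  set A := radialAverage 0 p with hA
  have hA0 : ∀ b, A b 0 = lam b := fun b => by rw [hA, radialAverage_zero, hlam]
  have hplip : LipFamily (fun _ _ => (1 : ℝ)) a p := (hbdd.derivWithin ha).smoothFamily (l := 0) ha
  have hgA : ∀ b, ∀ x ∈ Icc 0 a, g b x = x * A b x := fun b x hx =>
    eq_mul_radialAverage hplip (h0 b) (fun y hy => hbdd.hasDerivWithinAt b hy) hx
  obtain ⟨M, hM0, hM1, hM2, -⟩ := hplip.radialAverage 0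
  set c₁ := min a (c / 2 / (M + 1)) with hc₁
  have hc₁0 : 0 < c₁ := lt_min ha (by positivity)
  have hc₁a : c₁ ≤ a := min_le_left _ _
  have hs : Icc 0 c₁ ⊆ Icc 0 a := Icc_subset_Icc_right hc₁a
  have hAc : ∀ b, ∀ x ∈ Icc 0 c₁, c / 2 ≤ A b x := by
    intro b x hx
    have h1 := hM2 b x (hs hx) 0 ⟨le_rfl, ha.le⟩
    rw [sub_zero, abs_of_nonneg hx.1, ← hA, hA0] at h1
    have h2 : (M + 1) * c₁ ≤ c / 2 := by
      rw [← le_div_iff₀' (by positivity)]; exact min_le_right _ _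
    have h3 : M * x ≤ M * c₁ := by gcongr; exact hx.2
    have h4 := (abs_le.1 h1).1
    linarith [hlamc b]
  have hc2 : 0 < c / 2 := half_pos hc
  have hApos : ∀ b, ∀ x ∈ Icc 0 c₁, 0 < A b x := fun b x hx => hc2.trans_le (hAc b x hx)
  have hlam0 : ∀ b, 0 < lam b := fun b => hc.trans_le (hlamc b)
  refine ⟨c₁, (c / 2)⁻¹ * M, fun b x => Real.log (A b x) - Real.log (lam b), hc₁a,
    ⟨hc₁0, by positivity, hlam0, fun b => by simp [hA0], fun b x hx y hy => ?_⟩,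
    fun b x hx => ?_, fun σ l hσ hgl => ?_⟩
  · rw [sub_sub_sub_cancel_right, mul_assoc]
    refine (abs_log_sub_log_le hc2 (hAc b x hx) (hAc b y hy)).trans ?_
    gcongr
    exact hM2 b x (hs hx) y (hs hy)
  · rw [Real.exp_sub, Real.exp_log (hApos b x hx), Real.exp_log (hlam0 b), hgA b x (hs hx)]
    have := (hlam0 b).ne'
    field_simp
  · have hpk : CkFamily σ a (l + 1) p := hgl.derivWithin ha
    have hAl : SmoothFamily σ c₁ l A :=
      ((hpk.smoothFamily ha).radialAverage 0).mono_interval hc₁a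
    obtain ⟨N, hN0, hN1, hN2, hN3⟩ := hAl.lip
    have hz : (0 : ℝ) ∈ Icc 0 c₁ := ⟨le_rfl, hc₁0.le⟩
    have hlamN : ∀ b b', |lam b - lam b'| ≤ N * σ b b' := fun b b' => by
      simpa only [hA0] using hN3 b b' 0 hz
    have hlogl : ∀ b b', |Real.log (lam b) - Real.log (lam b')| ≤ c⁻¹ * N * σ b b' := fun b b' => by
      refine (abs_log_sub_log_le hc (hlamc b) (hlamc b')).trans ?_
      rw [mul_assoc]
      gcongr
      exact hlamN b b'
    have hlamN1 : ∀ b, lam b ≤ N := fun b => by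
      have := (le_abs_self _).trans (hN1 b 0 hz)
      rwa [hA0] at this
    refine ⟨hσ, ⟨N, hlamN⟩, (hAl.log hσ hc2 hAc).sub (SmoothFamily.of_base hσ
      (M := max |Real.log c| |Real.log N|) (fun b => ?_) hlogl), ?_⟩
    · exact abs_le_max_abs_abs (Real.log_le_log hc (hlamc b))
        (Real.log_le_log (hlam0 b) (hlamN1 b))
    obtain ⟨P, hP0, hP⟩ := CkFamily.exists_mixed_bound (g := p) ha (by
      obtain ⟨h1, M, hM0, hM1, hM2⟩ := hpk
      exact ⟨fun b => (h1 b).of_le (by exact_mod_cast (by omega)), M, hM0,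
        fun b j hj => hM1 b j (by omega), fun b b' j hj => hM2 b b' j (by omega)⟩)
    have hAP : ∀ b b', ∀ x ∈ Icc 0 c₁,
        |A b x - A b 0 - (A b' x - A b' 0)| ≤ P * σ b b' * x := by
      intro b b' x hx
      have hi := fun b {x} hx => intervalIntegrable_radial hplip 0 b (x := x) hx
      have hza : (0 : ℝ) ∈ Icc 0 a := ⟨le_rfl, ha.le⟩
      simp only [hA, radialAverage]
      rw [← intervalIntegral.integral_sub (hi b (hs hx)) (hi b hza),
        ← intervalIntegral.integral_sub (hi b' (hs hx)) (hi b' hza),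
        ← intervalIntegral.integral_sub ((hi b (hs hx)).sub (hi b hza))
          ((hi b' (hs hx)).sub (hi b' hza))]
      refine abs_integral_unit_le fun t ht => ?_
      have := hP b b' _ (mul_mem_Icc_of_mem_unit ht (hs hx))
      simp only [pow_zero, one_mul, mul_zero]
      refine this.trans ?_
      have h1 : t * x ≤ x := mul_le_of_le_one_left hx.1 ht.2
      have := hσ b b'
      gcongr
    have hlogA : ∀ b, ∀ x ∈ Icc 0 c₁, Real.log (A b x) - Real.log (lam b) =
        Real.log (A b x * (lam b)⁻¹) := fun b x hx => by
      rw [← div_eq_mul_inv, Real.log_div (hApos b x hx).ne' (hlam0 b).ne']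
    have hratio : ∀ b, ∀ x ∈ Icc 0 c₁, c / 2 * (N + 1)⁻¹ ≤ A b x * (lam b)⁻¹ := by
      intro b x hx
      have h1 := hAc b x hx
      have h2 := hlam0 b
      have h3 : lam b ≤ N + 1 := by linarith [hlamN1 b]
      have h4 := (hApos b x hx).le
      gcongr
    have hδ : 0 < c / 2 * (N + 1)⁻¹ := by positivity
    set δ := c / 2 * (N + 1)⁻¹
    refine ⟨max ((c / 2)⁻¹ * M) (δ⁻¹ * (N * (c⁻¹ * c⁻¹ * N) + c⁻¹ * P)), by positivity,
      fun b x hx y hy => ?_, fun b b' x hx => ?_⟩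
    · rw [sub_sub_sub_cancel_right]
      refine (abs_log_sub_log_le hc2 (hAc b x hx) (hAc b y hy)).trans ?_
      have h1 := hM2 b x (hs hx) y (hs hy)
      calc _ ≤ (c / 2)⁻¹ * (M * |x - y|) := by gcongr
        _ = (c / 2)⁻¹ * M * |x - y| := by ring
        _ ≤ _ := by gcongr; exact le_max_left _ _
    · dsimp only
      rw [hlogA b x hx, hlogA b' x hx]
      refine (abs_log_sub_log_le hδ (hratio b x hx) (hratio b' x hx)).trans ?_
      -- both ratios equal `1` at `x = 0`, so that only mixed differences contribute
      have e : A b x * (lam b)⁻¹ - A b' x * (lam b')⁻¹ =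
          (A b x - A b 0) * (lam b)⁻¹ - (A b' x - A b' 0) * (lam b')⁻¹ := by
        have h1 := (hlam0 b).ne'
        have h2 := (hlam0 b').ne'
        rw [hA0, hA0]
        field_simp
        ring
      have h1 : |A b x - A b 0| ≤ N * x := by
        have := hN2 b x hx 0 hz
        rwa [sub_zero, abs_of_nonneg hx.1] at this
      have h2 : |(lam b')⁻¹| ≤ c⁻¹ := by
        rw [abs_of_pos (inv_pos.2 (hlam0 b'))]
        exact inv_anti₀ hc (hlamc b')
      have h3 : |(lam b)⁻¹ - (lam b')⁻¹| ≤ c⁻¹ * c⁻¹ * (N * σ b b') := by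
        refine (abs_inv_sub_inv_le hc ((hlamc b).trans (le_abs_self _))
          ((hlamc b').trans (le_abs_self _))).trans ?_
        gcongr
        exact hlamN b b'
      have h4 := abs_mul_sub_mul_le h1 h2 (hAP b b' x hx) h3
      have h5 := mul_nonneg hx.1 (hσ b b')
      rw [e]
      calc _ ≤ δ⁻¹ * (N * x * (c⁻¹ * c⁻¹ * (N * σ b b')) + c⁻¹ * (P * σ b b' * x)) := by gcongr
        _ = δ⁻¹ * (N * (c⁻¹ * c⁻¹ * N) + c⁻¹ * P) * (x * σ b b') := by ring
        _ ≤ _ := by gcongr; exact le_max_right _ _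

theorem SmoothFamily.exists_cNorm_le (ha : 0 < a) (hσ : ∀ b b', 0 ≤ σ b b')
    (hg : SmoothFamily σ a l g) :
    ∃ C, 0 < C ∧ ∀ l' ≤ l, ∀ b b', cNorm l' (Icc 0 a) (g b - g b') ≤ ENNReal.ofReal (C * σ b b') := by
  have key : ∃ C, 0 < C ∧ ∀ j ≤ l, ∀ b b', ∀ x ∈ Icc 0 a,
      |iteratedDerivWithin j (g b - g b') (Icc 0 a) x| ≤ C * σ b b' := by
    induction l generalizing g with
    | zero =>
      obtain ⟨M, hM0, -, -, hM⟩ := hg.lip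
      refine ⟨M + 1, by positivity, fun j hj b b' x hx => ?_⟩
      obtain rfl : j = 0 := by omega
      rw [iteratedDerivWithin_zero]
      exact (hM b b' x hx).trans (mul_le_mul_of_nonneg_right (by linarith) (hσ b b'))
    | succ l ih =>
      obtain ⟨M, hM0, -, -, hM⟩ := hg.lip
      obtain ⟨g', h1, h2⟩ := hg.2
      obtain ⟨C, hC0, hC⟩ := ih h2
      refine ⟨M + C, by positivity, fun j hj b b' x hx => ?_⟩
      cases j with
      | zero =>
        rw [iteratedDerivWithin_zero]
        exact (hM b b' x hx).trans (mul_le_mul_of_nonneg_right (by linarith) (hσ b b'))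
      | succ j =>
        have e : iteratedDerivWithin (j + 1) (g b - g b') (Icc 0 a) x =
            iteratedDerivWithin j (g' b - g' b') (Icc 0 a) x := by
          rw [iteratedDerivWithin_succ']
          exact iteratedDerivWithin_congr (fun y hy => ((h1 b y hy).sub (h1 b' y hy)).derivWithin
            (uniqueDiffOn_Icc ha y hy)) hx
        rw [e]
        exact (hC j (by omega) b b' x hx).trans
          (mul_le_mul_of_nonneg_right (by linarith) (hσ b b'))
  obtain ⟨C, hC0, hC⟩ := key
  refine ⟨C, hC0, fun l' hl' b b' => ?_⟩
  refine iSup₂_le fun j hj => iSup₂_le fun x hx => ?_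
  rw [Real.enorm_eq_ofReal_abs]
  exact ENNReal.ofReal_le_ofReal (hC j (hj.trans hl') b b' x hx)

theorem SmoothFamily.contDiffOn (ha : 0 < a) (hg : SmoothFamily σ a l g) (b : B) :
    ContDiffOn ℝ l (g b) (Icc 0 a) := by
  induction l generalizing g with
  | zero =>
    rw [Nat.cast_zero, contDiffOn_zero]
    exact hg.lip.continuousOn b
  | succ l ih =>
    obtain ⟨g', h1, h2⟩ := hg.2
    rw [Nat.cast_succ, contDiffOn_succ_iff_derivWithin (uniqueDiffOn_Icc ha)]
    refine ⟨fun x hx => (h1 b x hx).differentiableWithinAt, by simp, (ih h2).congr fun x hx => ?_⟩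
    exact (h1 b x hx).derivWithin (uniqueDiffOn_Icc ha x hx)

end

/-! ### Growth of the toral automorphism on the universal cover -/

/-- The linear map of `ℝ^d` that lifts the toral automorphism. -/
noncomputable def coverMap {d : ℕ} (A : Matrix.GeneralLinearGroup (Fin d) ℤ) :
    (Fin d → ℝ) →ₗ[ℝ] (Fin d → ℝ) :=
  Matrix.mulVecLin (A.val.map (fun n : ℤ => (n : ℝ)))

/-- The covering projection `ℝ^d → 𝕋^d`. -/
def torusProj {d : ℕ} (v : Fin d → ℝ) : Torus d := fun i => (v i : UnitAddCircle)

section Growth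

open scoped Matrix.Norms.Operator

theorem exists_pow_coverMap_le {d : ℕ} (A : Matrix.GeneralLinearGroup (Fin d) ℤ) {ν : ℝ}
    (hν : maxEigenvalueNorm A < ν) :
    ∃ n : ℕ, 0 < n ∧ ∀ v, ‖(coverMap A ^ n) v‖ ≤ ν ^ n * ‖v‖ := by
  have hν0 : 0 < ν := ENNReal.toReal_nonneg.trans_lt hν
  rcases isEmpty_or_nonempty (Fin d) with hd | hd
  · refine ⟨1, one_pos, fun v => ?_⟩
    rw [Subsingleton.elim ((coverMap A ^ 1) v) 0, norm_zero]
    positivity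
  set a := complexMatrix A with ha
  set R := A.val.map (fun n : ℤ => (n : ℝ)) with hR
  have hfin : spectralRadius ℂ a ≠ ⊤ :=
    ((spectrum.spectralRadius_le_nnnorm a).trans_lt ENNReal.coe_lt_top).ne
  have hlt : spectralRadius ℂ a < ENNReal.ofReal ν :=
    (ENNReal.lt_ofReal_iff_toReal_lt hfin).2 hν
  have hev := (spectrum.pow_norm_pow_one_div_tendsto_nhds_spectralRadius a).eventually_lt_const hlt
  obtain ⟨n, hn, hn0⟩ := (hev.and (Filter.eventually_gt_atTop 0)).exists
  refine ⟨n, hn0, fun v => ?_⟩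
  have hpow : a ^ n = (R ^ n).map (fun x : ℝ => (x : ℂ)) := by
    have h1 : a = (Complex.ofRealHom.mapMatrix) R := by
      ext i j; simp [ha, hR, complexMatrix]
    rw [h1, ← map_pow]
    rfl
  have hnorm : ‖a ^ n‖ = ‖R ^ n‖ := by
    rw [hpow, Matrix.linfty_opNorm_def, Matrix.linfty_opNorm_def]
    simp
  have hlin : (coverMap A ^ n) v = (R ^ n).mulVec v := by
    have : coverMap A = Matrix.toLin' R := rfl
    rw [this, ← Matrix.toLin'_pow, Matrix.toLin'_apply]
  have hle : ‖a ^ n‖ ≤ ν ^ n := by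
    have h1 : ‖a ^ n‖ ^ (1 / n : ℝ) < ν := (ENNReal.ofReal_lt_ofReal_iff hν0).1 hn
    have hn' : (n : ℝ) ≠ 0 := by exact_mod_cast hn0.ne'
    calc ‖a ^ n‖ = (‖a ^ n‖ ^ (1 / n : ℝ)) ^ n := by
          rw [← Real.rpow_natCast, ← Real.rpow_mul (norm_nonneg _), one_div_mul_cancel hn',
            Real.rpow_one]
      _ ≤ ν ^ n := by gcongr
  rw [hlin]
  refine (Matrix.linfty_opNorm_mulVec _ _).trans ?_
  rw [← hnorm]
  gcongr

end Growth

/-- A function equivalent to the norm that is expanded by at most the factor `ν` in a single step,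
provided that some iterate expands the norm at this rate. -/
theorem exists_adapted_norm {E : Type*} [NormedAddCommGroup E] [NormedSpace ℝ E]
    [FiniteDimensional ℝ E] (T : E →ₗ[ℝ] E) {ν : ℝ} (hν : 0 < ν) {n : ℕ} (hn : 0 < n)
    (hT : ∀ v, ‖(T ^ n) v‖ ≤ ν ^ n * ‖v‖) :
    ∃ (N : E → ℝ) (C : ℝ), 0 < C ∧ ∀ v, ‖v‖ ≤ N v ∧ N v ≤ C * ‖v‖ ∧ N (T v) ≤ ν * N v := by
  have hbd : ∀ i : ℕ, ∃ K, 0 ≤ K ∧ ∀ v, ‖(T ^ i) v‖ ≤ K * ‖v‖ := fun i =>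
    ⟨‖LinearMap.toContinuousLinearMap (T ^ i)‖, norm_nonneg _,
      fun v => (LinearMap.toContinuousLinearMap (T ^ i)).le_opNorm v⟩
  choose K hK0 hK using hbd
  refine ⟨fun v => ∑ i ∈ Finset.range n, (ν ^ i)⁻¹ * ‖(T ^ i) v‖,
    1 + ∑ i ∈ Finset.range n, (ν ^ i)⁻¹ * K i, ?_, fun v => ⟨?_, ?_, ?_⟩⟩
  · have : 0 ≤ ∑ i ∈ Finset.range n, (ν ^ i)⁻¹ * K i :=
      Finset.sum_nonneg fun i _ => mul_nonneg (by positivity) (hK0 i)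
    linarith
  · have := Finset.single_le_sum (f := fun i => (ν ^ i)⁻¹ * ‖(T ^ i) v‖)
      (fun i _ => by positivity) (Finset.mem_range.2 hn)
    simpa using this
  · rw [add_mul, Finset.sum_mul, one_mul]
    refine le_add_of_nonneg_of_le (norm_nonneg _) (Finset.sum_le_sum fun i _ => ?_)
    rw [mul_assoc]
    gcongr
    exact hK i v
  · have h1 := Finset.sum_range_succ (fun i => (ν ^ i)⁻¹ * ‖(T ^ i) v‖) n
    have h2 := Finset.sum_range_succ' (fun i => (ν ^ i)⁻¹ * ‖(T ^ i) v‖) n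
    have h3 : (ν ^ n)⁻¹ * ‖(T ^ n) v‖ ≤ ‖v‖ := by
      rw [inv_mul_le_iff₀ (by positivity)]
      exact hT v
    have h4 : ∑ i ∈ Finset.range n, (ν ^ i)⁻¹ * ‖(T ^ i) (T v)‖ =
        ν * ∑ i ∈ Finset.range n, (ν ^ (i + 1))⁻¹ * ‖(T ^ (i + 1)) v‖ := by
      rw [Finset.mul_sum]
      refine Finset.sum_congr rfl fun i _ => ?_
      rw [pow_succ T, Module.End.mul_apply, pow_succ ν]
      field_simp
    simp only [pow_zero, inv_one, one_mul, Module.End.one_apply] at h2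
    dsimp only
    rw [h4]
    refine mul_le_mul_of_nonneg_left ?_ hν.le
    linarith

/-- A gauge equivalent to `‖v - w‖ ^ α` whose expansion in one step of the lifted automorphism is
compensated by the factor `q`. -/
theorem exists_adapted_gauge {d : ℕ} (A : Matrix.GeneralLinearGroup (Fin d) ℤ) {q α : ℝ}
    (hα : 0 < α) (h : q * maxEigenvalueNorm A ^ α < 1) :
    ∃ (σ : (Fin d → ℝ) → (Fin d → ℝ) → ℝ) (κ C : ℝ), 0 ≤ C ∧ q * κ < 1 ∧
      (∀ v w, σ (coverMap A v) (coverMap A w) ≤ κ * σ v w) ∧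
      ∀ v w, ‖v - w‖ ^ α ≤ σ v w ∧ σ v w ≤ C * ‖v - w‖ ^ α := by
  set μ := maxEigenvalueNorm A with hμ
  have hcont : ContinuousAt (fun ν : ℝ => q * ν ^ α) μ :=
    continuousAt_const.mul (Real.continuousAt_rpow_const μ α (Or.inr hα.le))
  have hev : ∀ᶠ ν in 𝓝[>] μ, q * ν ^ α < 1 :=
    (hcont.eventually_lt_const h).filter_mono nhdsWithin_le_nhds
  obtain ⟨ν, hν, hνμ⟩ := (hev.and self_mem_nhdsWithin).exists
  have hν0 : 0 < ν := ENNReal.toReal_nonneg.trans_lt hνμ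
  obtain ⟨n, hn, hT⟩ := exists_pow_coverMap_le A hνμ
  obtain ⟨N, C, hC, hN⟩ := exists_adapted_norm (coverMap A) hν0 hn hT
  have hN0 : ∀ v, 0 ≤ N v := fun v => (norm_nonneg v).trans (hN v).1
  refine ⟨fun v w => N (v - w) ^ α, ν ^ α, C ^ α, by positivity, hν, fun v w => ?_,
    fun v w => ⟨?_, ?_⟩⟩
  · dsimp only
    rw [← map_sub, ← Real.mul_rpow hν0.le (hN0 _)]
    exact Real.rpow_le_rpow (hN0 _) (hN _).2.2 hα.le
  · exact Real.rpow_le_rpow (norm_nonneg _) (hN _).1 hα.le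
  · rw [← Real.mul_rpow hC.le (norm_nonneg _)]
    exact Real.rpow_le_rpow (hN0 _) (hN _).2.1 hα.le

/-- Below the critical exponent `log_μ (1 / q)` the fiber contraction dominates the expansion of the
base. For `μ ≤ 1` there is no positive exponent below the value of `Real.logb`. -/
theorem mul_rpow_lt_one_of_lt_logb {q μ α : ℝ} (hq0 : 0 < q) (hq : q < 1) (hμ : 0 ≤ μ) (hα : 0 < α)
    (h : α < Real.logb μ (1 / q)) : q * μ ^ α < 1 := by
  have hlogq : 0 < Real.log (1 / q) := Real.log_pos (by rw [lt_div_iff₀ hq0]; linarith)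
  have hlogμ : 0 < Real.log μ := by
    by_contra hneg
    have : Real.logb μ (1 / q) ≤ 0 := div_nonpos_of_nonneg_of_nonpos hlogq.le (not_lt.1 hneg)
    linarith
  have hμ0 : 0 < μ := hμ.lt_of_ne (by rintro rfl; simp at hlogμ)
  have h1 : α * Real.log μ < Real.log (1 / q) := (lt_div_iff₀ hlogμ).1 h
  have h2 : μ ^ α < 1 / q := by
    rw [Real.rpow_def_of_pos hμ0, ← Real.lt_log_iff_exp_lt (by positivity)]
    linarith
  calc q * μ ^ α < q * (1 / q) := by gcongr
    _ = 1 := by field_simp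

theorem exists_exponent {q μ β : ℝ} (hq0 : 0 < q) (hq : q < 1) (hμ : 0 ≤ μ) (hβ : 0 < β) :
    ∃ α, 0 < α ∧ α < β ∧ q * μ ^ α < 1 := by
  have hM : 0 < max μ 1 := lt_max_of_lt_right one_pos
  have hcont : ContinuousAt (fun α : ℝ => q * (max μ 1) ^ α) 0 :=
    continuousAt_const.mul (Real.continuousAt_const_rpow hM.ne')
  have h0 : q * (max μ 1) ^ (0 : ℝ) < 1 := by simpa using hq
  have hev : ∀ᶠ α in 𝓝[>] (0 : ℝ), q * (max μ 1) ^ α < 1 :=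
    (hcont.eventually_lt_const h0).filter_mono nhdsWithin_le_nhds
  have hev2 : ∀ᶠ α in 𝓝[>] (0 : ℝ), α < β :=
    (eventually_lt_nhds hβ).filter_mono nhdsWithin_le_nhds
  obtain ⟨α, ⟨h1, h2⟩, h3⟩ := ((hev.and hev2).and self_mem_nhdsWithin).exists
  have h3' : (0 : ℝ) < α := h3
  refine ⟨α, h3', h2, lt_of_le_of_lt ?_ h1⟩
  gcongr
  exact le_max_left _ _

/-! ### Lifting points of the torus to the universal cover -/

section Cover

variable {d : ℕ}

theorem torusProj_sub (v w : Fin d → ℝ) : torusProj (v - w) = torusProj v - torusProj w := by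
  ext i; simp [torusProj]

theorem torusAut_torusProj (A : Matrix.GeneralLinearGroup (Fin d) ℤ) (v : Fin d → ℝ) :
    torusAut A (torusProj v) = torusProj (coverMap A v) := by
  ext i
  simp only [torusAut, torusProj, coverMap, Matrix.mulVecLin_apply, Matrix.mulVec, dotProduct,
    Matrix.map_apply]
  rw [← QuotientAddGroup.mk'_apply, map_sum]
  refine Finset.sum_congr rfl fun j _ => ?_
  rw [← zsmul_eq_mul, map_zsmul]
  rfl

theorem torusAut_add (A : Matrix.GeneralLinearGroup (Fin d) ℤ) (b b' : Torus d) :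
    torusAut A (b + b') = torusAut A b + torusAut A b' := by
  ext i
  simp [torusAut, Finset.sum_add_distrib]

theorem norm_unitAddCircle_le (x : ℝ) : ‖(x : UnitAddCircle)‖ ≤ |x| := by
  rw [UnitAddCircle.norm_eq]
  simpa using round_le x 0

theorem norm_unitAddCircle_eq {x : ℝ} (hx : |x| ≤ 1 / 2) : ‖(x : UnitAddCircle)‖ = |x| :=
  (AddCircle.norm_coe_eq_abs_iff (1 : ℝ) one_ne_zero).2 (by simpa using hx)

theorem norm_torusProj_le (v : Fin d → ℝ) : ‖torusProj v‖ ≤ ‖v‖ :=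
  (pi_norm_le_iff_of_nonneg (norm_nonneg v)).2 fun i =>
    (norm_unitAddCircle_le (v i)).trans (norm_le_pi_norm v i)

theorem norm_torusProj {v : Fin d → ℝ} (hv : ‖v‖ ≤ 1 / 2) : ‖torusProj v‖ = ‖v‖ := by
  refine le_antisymm (norm_torusProj_le v) ?_
  refine (pi_norm_le_iff_of_nonneg (norm_nonneg _)).2 fun i => ?_
  rw [Real.norm_eq_abs, ← norm_unitAddCircle_eq ((norm_le_pi_norm v i).trans hv)]
  exact norm_le_pi_norm (torusProj v) i

theorem norm_torus_le (b : Torus d) : ‖b‖ ≤ 1 / 2 :=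
  (pi_norm_le_iff_of_nonneg (by norm_num)).2 fun i => by
    simpa using AddCircle.norm_le_half_period (1 : ℝ) (x := b i) one_ne_zero

theorem exists_lift (b : Torus d) : ∃ v, torusProj v = b ∧ ‖v‖ = ‖b‖ := by
  have : ∀ i, ∃ x : ℝ, (x : UnitAddCircle) = b i ∧ |x| ≤ 1 / 2 := by
    intro i
    obtain ⟨y, hy⟩ := QuotientAddGroup.mk_surjective (b i)
    refine ⟨y - round y, ?_, abs_sub_round y⟩
    rw [← hy, AddCircle.coe_sub]
    have : ((round y : ℝ) : UnitAddCircle) = 0 := by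
      rw [AddCircle.coe_eq_zero_iff]
      exact ⟨round y, by simp⟩
    rw [this, sub_zero]
  choose v hv hv2 using this
  have hb : torusProj v = b := funext hv
  refine ⟨v, hb, ?_⟩
  rw [← hb, norm_torusProj]
  exact (pi_norm_le_iff_of_nonneg (by norm_num)).2 hv2

theorem eq_of_torusProj_eq {v w : Fin d → ℝ} (h : torusProj v = torusProj w)
    (hvw : ‖v - w‖ ≤ 1 / 2) : v = w := by
  have := norm_torusProj hvw
  rw [torusProj_sub, h, sub_self, norm_zero] at this
  exact sub_eq_zero.1 (norm_eq_zero.1 this.symm)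

/-- The coordinatewise retraction of `ℝ^d` onto the ball of radius `δ`. -/
def clampCube (δ : ℝ) (v : Fin d → ℝ) : Fin d → ℝ := fun i => max (-δ) (min δ (v i))

theorem norm_clampCube_le {δ : ℝ} (hδ : 0 ≤ δ) (v : Fin d → ℝ) : ‖clampCube δ v‖ ≤ δ := by
  refine (pi_norm_le_iff_of_nonneg hδ).2 fun i => ?_
  exact abs_le.2 ⟨le_max_left _ _, max_le (by linarith) (min_le_left _ _)⟩

theorem clampCube_eq {δ : ℝ} {v : Fin d → ℝ} (hv : ‖v‖ ≤ δ) : clampCube δ v = v := by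
  ext i
  have := abs_le.1 ((norm_le_pi_norm v i).trans hv)
  simp only [clampCube]
  rw [min_eq_right this.2, max_eq_right this.1]

theorem norm_clampCube_sub_le (δ : ℝ) (v w : Fin d → ℝ) :
    ‖clampCube δ v - clampCube δ w‖ ≤ ‖v - w‖ := by
  refine (pi_norm_le_iff_of_nonneg (norm_nonneg _)).2 fun i => ?_
  refine le_trans ?_ (norm_le_pi_norm (v - w) i)
  simp only [clampCube, Pi.sub_apply, Real.norm_eq_abs]
  refine (abs_max_sub_max_le_max _ _ _ _).trans ?_
  rw [sub_self, abs_zero]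
  refine max_le (abs_nonneg _) ((abs_min_sub_min_le_max _ _ _ _).trans ?_)
  simp

end Cover

/-! ### The lifted family -/

section Lifted

theorem CkFamily.comp_base {B B' : Type*} {σ' : B' → B' → ℝ} {σ : B → B → ℝ} {a K : ℝ} {k : ℕ}
    {g : B' → ℝ → ℝ} (hg : CkFamily σ' a k g) (τ : B → B') (hσ : ∀ b b', 0 ≤ σ b b')
    (hτ : ∀ b b', σ' (τ b) (τ b') ≤ K * σ b b') : CkFamily σ a k (fun b => g (τ b)) := by
  obtain ⟨h1, M, hM0, hM1, hM2⟩ := hg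
  refine ⟨fun b => h1 _, max M (M * K), le_max_of_le_left hM0,
    fun b j hj x hx => (hM1 _ j hj x hx).trans (le_max_left _ _), fun b b' j hj x hx => ?_⟩
  calc _ ≤ M * σ' (τ b) (τ b') := hM2 _ _ j hj x hx
    _ ≤ M * (K * σ b b') := by gcongr; exact hτ b b'
    _ = M * K * σ b b' := by ring
    _ ≤ _ := mul_le_mul_of_nonneg_right (le_max_right _ _) (hσ b b')

theorem abs_iteratedDerivWithin_le_of_cNorm_le {k j : ℕ} {J : Set ℝ} {g : ℝ → ℝ} {C : ℝ}
    (hC : 0 ≤ C) (h : cNorm k J g ≤ ENNReal.ofReal C) (hj : j ≤ k) {x : ℝ} (hx : x ∈ J) :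
    |iteratedDerivWithin j g J x| ≤ C := by
  have h1 : ‖iteratedDerivWithin j g J x‖ₑ ≤ cNorm k J g :=
    le_iSup₂_of_le (f := fun (j : ℕ) (_ : j ≤ k) =>
      ⨆ (x : ℝ) (_ : x ∈ J), ‖iteratedDerivWithin j g J x‖ₑ) j hj
      (le_iSup₂_of_le (f := fun (x : ℝ) (_ : x ∈ J) => ‖iteratedDerivWithin j g J x‖ₑ) x hx le_rfl)
  have h2 := h1.trans h
  rw [Real.enorm_eq_ofReal_abs] at h2
  exact (ENNReal.ofReal_le_ofReal_iff hC).1 h2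

variable {d k : ℕ} {f : Torus d → ℝ → ℝ} {β : ℝ}

theorem dist_torus_le (b b' : Torus d) : dist b b' ≤ 1 := by
  rw [dist_eq_norm]
  exact (norm_torus_le _).trans (by norm_num)

theorem ckFamily_of_holder (hf : ∀ b, IsFiberDiffeo k (f b)) (hβ : 0 < β)
    (hHolder : ∃ C : ℝ, 0 < C ∧ ∀ b b' : Torus d,
      cNorm k fiberI (f b - f b') ≤ ENNReal.ofReal (C * dist b b' ^ β)) :
    CkFamily (fun b b' => dist b b' ^ β) 1 k f := by
  obtain ⟨C, hC0, hC⟩ := hHolder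
  have hdiff : ∀ b b', ∀ j ≤ k, ∀ x ∈ Icc (0 : ℝ) 1,
      |iteratedDerivWithin j (f b - f b') (Icc 0 1) x| ≤ C * dist b b' ^ β :=
    fun b b' j hj x hx => abs_iteratedDerivWithin_le_of_cNorm_le (by positivity) (hC b b') hj hx
  have hu := uniqueDiffOn_Icc (zero_lt_one (α := ℝ))
  have hbd : ∀ j : ℕ, ∃ K, 0 ≤ K ∧ (j ≤ k → ∀ x ∈ Icc (0 : ℝ) 1,
      |iteratedDerivWithin j (f 0) (Icc 0 1) x| ≤ K) := by
    intro j
    by_cases hj : j ≤ k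
    · obtain ⟨K, hK⟩ := isCompact_Icc.exists_bound_of_continuousOn
        ((hf 0).contDiffOn.continuousOn_iteratedDerivWithin (m := j) (by exact_mod_cast hj) hu)
      exact ⟨max 0 K, le_max_left _ _, fun _ x hx => (hK x hx).trans (le_max_right _ _)⟩
    · exact ⟨0, le_rfl, fun h => absurd h hj⟩
  choose K hK0 hK using hbd
  have hsum : 0 ≤ ∑ j ∈ Finset.range (k + 1), K j := Finset.sum_nonneg fun j _ => hK0 j
  refine ⟨fun b => (hf b).contDiffOn, C + ∑ j ∈ Finset.range (k + 1), K j, by positivity,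
    fun b j hj x hx => ?_, fun b b' j hj x hx => ?_⟩
  · have h1 : iteratedDerivWithin j (f b) (Icc 0 1) x =
        iteratedDerivWithin j (f b - f 0) (Icc 0 1) x + iteratedDerivWithin j (f 0) (Icc 0 1) x := by
      rw [iteratedDerivWithin_sub hx hu (((hf b).contDiffOn x hx).of_le (by exact_mod_cast hj))
        (((hf 0).contDiffOn x hx).of_le (by exact_mod_cast hj)), sub_add_cancel]
    rw [h1]
    refine (abs_add_le _ _).trans (add_le_add ?_ ?_)
    · refine (hdiff b 0 j hj x hx).trans (mul_le_of_le_one_right hC0.le ?_)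
      exact Real.rpow_le_one dist_nonneg (dist_torus_le _ _) hβ.le
    · refine (hK j hj x hx).trans ?_
      exact Finset.single_le_sum (fun i _ => hK0 i) (Finset.mem_range.2 (by omega))
  · refine (hdiff b b' j hj x hx).trans ?_
    gcongr
    linarith

/-- The fiber maps over a small neighborhood of `b₀`, extended to a family over the universal cover by
means of a Lipschitz retraction, in the normal form `x ↦ lam v * (x * exp (r v x))`. -/
theorem exists_lifted_data (hk : 2 ≤ k) (hf : ∀ b, IsFiberDiffeo k (f b)) (hβ : 0 < β)
    (hHolder : ∃ C : ℝ, 0 < C ∧ ∀ b b' : Torus d,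
      cNorm k fiberI (f b - f b') ≤ ENNReal.ofReal (C * dist b b' ^ β))
    (b₀ : Torus d) {lo hi : ℝ} (hlo : 0 < lo) (hlo' : lo < fiberMultiplier f b₀)
    (hhi : fiberMultiplier f b₀ < hi) :
    ∃ (δ c₁ L : ℝ) (lam : (Fin d → ℝ) → ℝ) (r : (Fin d → ℝ) → ℝ → ℝ), 0 < δ ∧ c₁ ≤ 1 ∧
      (∀ v, lo ≤ lam v ∧ lam v ≤ hi) ∧ FiberData lam r c₁ L ∧
      (∀ v, ‖v‖ ≤ δ → lam v = fiberMultiplier f (b₀ + torusProj v) ∧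
        ∀ x ∈ Icc 0 c₁, f (b₀ + torusProj v) x = lam v * (x * Real.exp (r v x))) ∧
      ∀ (α : ℝ) (σ : (Fin d → ℝ) → (Fin d → ℝ) → ℝ), 0 < α → α ≤ β →
        (∀ v w, ‖v - w‖ ^ α ≤ σ v w) → RegularData σ (k - 2) lam r c₁ := by
  have hCk := ckFamily_of_holder hf hβ hHolder
  obtain ⟨l, rfl⟩ : ∃ l, k = l + 2 := ⟨k - 2, by omega⟩
  obtain ⟨M, hM0, hM1, -, hM2⟩ := ((hCk.derivWithin one_pos).smoothFamily (l := l) one_pos).lip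
  have hmult : ∀ b b', |fiberMultiplier f b - fiberMultiplier f b'| ≤ M * dist b b' ^ β :=
    fun b b' => hM2 b b' 0 ⟨le_rfl, zero_le_one⟩
  have hcont : Filter.Tendsto (fun δ : ℝ => M * δ ^ β) (𝓝[>] 0) (𝓝 0) := by
    have : ContinuousAt (fun δ : ℝ => M * δ ^ β) 0 :=
      continuousAt_const.mul (Real.continuousAt_rpow_const 0 β (Or.inr hβ.le))
    have h0 := this.tendsto
    rw [Real.zero_rpow hβ.ne', mul_zero] at h0
    exact h0.mono_left nhdsWithin_le_nhds
  have hη : 0 < min (fiberMultiplier f b₀ - lo) (hi - fiberMultiplier f b₀) :=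
    lt_min (sub_pos.2 hlo') (sub_pos.2 hhi)
  obtain ⟨δ, hδη, hδ⟩ := ((hcont.eventually_lt_const hη).and self_mem_nhdsWithin).exists
  have hδ0 : 0 < δ := hδ
  set τ : (Fin d → ℝ) → Torus d := fun v => b₀ + torusProj (clampCube δ v) with hτ
  have hτd : ∀ v w, dist (τ v) (τ w) ≤ ‖v - w‖ := by
    intro v w
    rw [dist_eq_norm, hτ, add_sub_add_left_eq_sub, ← torusProj_sub]
    exact (norm_torusProj_le _).trans (norm_clampCube_sub_le _ _ _)
  have hτ0 : ∀ v, dist (τ v) b₀ ≤ δ := by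
    intro v
    rw [dist_eq_norm, hτ, add_sub_cancel_left]
    exact (norm_torusProj_le _).trans (norm_clampCube_le hδ0.le v)
  have hlam : ∀ v, lo ≤ fiberMultiplier f (τ v) ∧ fiberMultiplier f (τ v) ≤ hi := by
    intro v
    have h1 : |fiberMultiplier f (τ v) - fiberMultiplier f b₀| ≤ M * δ ^ β := by
      refine (hmult _ _).trans ?_
      gcongr
      exact hτ0 v
    have h2 := abs_le.1 (h1.trans hδη.le)
    have h3 := min_le_left (fiberMultiplier f b₀ - lo) (hi - fiberMultiplier f b₀)
    have h4 := min_le_right (fiberMultiplier f b₀ - lo) (hi - fiberMultiplier f b₀)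
    constructor <;> linarith
  have hbdd : CkFamily (fun _ _ => (1 : ℝ)) 1 (l + 2) (fun v => f (τ v)) :=
    hCk.comp_base (K := 1) τ (fun _ _ => zero_le_one) fun v w => by
      rw [one_mul]; exact Real.rpow_le_one dist_nonneg (dist_torus_le _ _) hβ.le
  have hbdd2 : CkFamily (fun _ _ => (1 : ℝ)) 1 2 (fun v => f (τ v)) := by
    obtain ⟨h1, M, hM0, hM1, hM2⟩ := hbdd
    exact ⟨fun b => (h1 b).of_le (by exact_mod_cast (by omega)), M, hM0,
      fun b j hj => hM1 b j (by omega), fun b b' j hj => hM2 b b' j (by omega)⟩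
  obtain ⟨c₁, L, r, hc₁, hdata, heq, hreg⟩ := exists_fiberData one_pos hlo
    (fun v => (hf (τ v)).map_zero) (lam := fun v => fiberMultiplier f (τ v)) (fun v => rfl)
    (fun v => (hlam v).1) hbdd2
  refine ⟨δ, c₁, L, _, r, hδ0, hc₁, hlam, hdata, fun v hv => ?_, fun α σ hα hαβ hσ => ?_⟩
  · have hv' : b₀ + torusProj v = τ v := by simp only [hτ]; rw [clampCube_eq hv]
    rw [hv']
    exact ⟨rfl, heq v⟩
  · have hσ0 : ∀ v w, 0 ≤ σ v w := fun v w => le_trans (by positivity) (hσ v w)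
    refine hreg σ l hσ0 (hCk.comp_base (K := 1) τ hσ0 fun v w => ?_)
    calc dist (τ v) (τ w) ^ β ≤ dist (τ v) (τ w) ^ α :=
          Real.rpow_le_rpow_of_exponent_ge' dist_nonneg (dist_torus_le _ _) hα.le hαβ
      _ ≤ ‖v - w‖ ^ α := Real.rpow_le_rpow dist_nonneg (hτd v w) hα.le
      _ ≤ 1 * σ v w := by rw [one_mul]; exact hσ v w

end Lifted

section Reparametrization

variable {B B' : Type*} {lam : B' → ℝ} {r : B' → ℝ → ℝ} {a L : ℝ}

theorem FiberData.comp_base (h : FiberData lam r a L) (τ : B → B') :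
    FiberData (fun b => lam (τ b)) (fun b => r (τ b)) a L :=
  ⟨h.interval_pos, h.nonneg, fun _ => h.lam_pos _, fun _ => h.map_zero _, fun _ => h.lipschitz _⟩

theorem RegularData.comp_base {σ' : B' → B' → ℝ} {σ : B → B → ℝ} {l : ℕ} {K : ℝ}
    (h : RegularData σ' l lam r a) (τ : B → B') (hσ : ∀ b b', 0 ≤ σ b b')
    (hτ : ∀ b b', σ' (τ b) (τ b') ≤ K * σ b b') :
    RegularData σ l (fun b => lam (τ b)) (fun b => r (τ b)) a := by
  refine ⟨hσ, ?_, ?_, ?_⟩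
  · obtain ⟨N, hN⟩ := h.lam_holder
    refine ⟨|N| * K, fun b b' => ?_⟩
    calc _ ≤ N * σ' (τ b) (τ b') := hN _ _
      _ ≤ |N| * σ' (τ b) (τ b') :=
        mul_le_mul_of_nonneg_right (le_abs_self N) (h.gauge_nonneg _ _)
      _ ≤ |N| * (K * σ b b') := by gcongr; exact hτ b b'
      _ = _ := by ring
  · exact h.smooth.comp (SmoothFamily.id hσ) (fun _ _ hx => hx) hσ hτ
  · obtain ⟨M, hM0, hM1, hM2⟩ := h.weighted
    refine ⟨max M (M * K), le_max_of_le_left hM0,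
      fun b x hx y hy => (hM1 _ x hx y hy).trans (by gcongr; exact le_max_left _ _),
      fun b b' x hx => ?_⟩
    calc _ ≤ M * (x * σ' (τ b) (τ b')) := hM2 _ _ x hx
      _ ≤ M * (x * (K * σ b b')) := by
        have := hx.1
        gcongr
        exact hτ b b'
      _ = M * K * (x * σ b b') := by ring
      _ ≤ _ := by
        have := mul_nonneg hx.1 (hσ b b')
        gcongr
        exact le_max_right _ _

end Reparametrization

/-! ### Descent to the torus -/

section Descent

theorem isEmbedding_fiberwise {X : Type*} [PseudoMetricSpace X] {V : Set X} {J : Set ℝ}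
    {K : X → ℝ → ℝ} {M α : ℝ} (hα : 0 < α)
    (hx : ∀ b ∈ V, ∀ x ∈ J, ∀ y ∈ J, |K b x - K b y| ≤ M * |x - y|)
    (hb : ∀ b ∈ V, ∀ b' ∈ V, ∀ x ∈ J, |K b x - K b' x| ≤ M * dist b b' ^ α)
    (hinv : ∀ b ∈ V, ∀ x ∈ J, ∀ y ∈ J, |x - y| ≤ 2 * |K b x - K b y|) :
    IsEmbedding ((V ×ˢ J).domRestrict (fun p : X × ℝ => (p.1, K p.1 p.2))) := by
  have hdist : ∀ (F : Filter (V ×ˢ J)) (p : V ×ˢ J),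
      Filter.Tendsto (fun p' : V ×ˢ J => p'.1.1) F (𝓝 p.1.1) →
      Filter.Tendsto (fun p' : V ×ˢ J => M * dist p'.1.1 p.1.1 ^ α) F (𝓝 0) := by
    intro F p h
    have h1 := (tendsto_iff_dist_tendsto_zero.1 h).rpow_const (p := α) (Or.inr hα.le)
    rw [Real.zero_rpow hα.ne'] at h1
    simpa using h1.const_mul M
  refine ⟨isInducing_iff_nhds.2 fun p => le_antisymm ?_ ?_, ?_⟩
  · rw [← Filter.tendsto_iff_comap]
    have h1 : Filter.Tendsto (fun p' : V ×ˢ J => p'.1.1) (𝓝 p) (𝓝 p.1.1) :=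
      (continuous_fst.comp continuous_subtype_val).tendsto p
    have h2 : Filter.Tendsto (fun p' : V ×ˢ J => p'.1.2) (𝓝 p) (𝓝 p.1.2) :=
      (continuous_snd.comp continuous_subtype_val).tendsto p
    refine h1.prodMk_nhds ?_
    rw [tendsto_iff_dist_tendsto_zero]
    have h3 := ((tendsto_iff_dist_tendsto_zero.1 h2).const_mul M).add (hdist _ p h1)
    rw [mul_zero, add_zero] at h3
    refine squeeze_zero (fun _ => dist_nonneg) (fun p' => ?_) h3
    rw [Real.dist_eq, Real.dist_eq]
    exact (abs_sub_le _ (K p'.1.1 p.1.2) _).trans (add_le_add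
      (hx _ p'.2.1 _ p'.2.2 _ p.2.2) (hb _ p'.2.1 _ p.2.1 _ p.2.2))
  · set Φ := (V ×ˢ J).domRestrict (fun p : X × ℝ => (p.1, K p.1 p.2)) with hΦ
    have h0 : Filter.Tendsto Φ (Filter.comap Φ (𝓝 (Φ p))) (𝓝 (Φ p)) := Filter.tendsto_comap
    have h1 : Filter.Tendsto (fun p' : V ×ˢ J => p'.1.1) (Filter.comap Φ (𝓝 (Φ p))) (𝓝 p.1.1) :=
      h0.fst_nhds
    have h2 : Filter.Tendsto (fun p' : V ×ˢ J => K p'.1.1 p'.1.2) (Filter.comap Φ (𝓝 (Φ p)))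
        (𝓝 (K p.1.1 p.1.2)) := h0.snd_nhds
    have h3 : Filter.Tendsto (fun p' : V ×ˢ J => p'.1.2) (Filter.comap Φ (𝓝 (Φ p))) (𝓝 p.1.2) := by
      rw [tendsto_iff_dist_tendsto_zero]
      have h4 := ((tendsto_iff_dist_tendsto_zero.1 h2).add (hdist _ p h1)).const_mul 2
      rw [add_zero, mul_zero] at h4
      refine squeeze_zero (fun _ => dist_nonneg) (fun p' => ?_) h4
      rw [Real.dist_eq, Real.dist_eq]
      refine (hinv _ p'.2.1 _ p'.2.2 _ p.2.2).trans ?_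
      gcongr
      refine (abs_sub_le _ (K p.1.1 p.1.2) _).trans ?_
      gcongr
      rw [abs_sub_comm]
      exact hb _ p'.2.1 _ p.2.1 _ p.2.2
    rw [nhds_subtype, ← Filter.tendsto_iff_comap]
    exact h1.prodMk_nhds h3
  · rintro ⟨⟨b, x⟩, hp⟩ ⟨⟨b', x'⟩, hp'⟩ h
    have h1 : (b, K b x) = (b', K b' x') := h
    obtain ⟨rfl, h2⟩ := Prod.mk.inj h1
    have h3 := hinv b hp.1 x hp.2 x' hp'.2
    rw [h2, sub_self, abs_zero, mul_zero] at h3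
    have h4 : x = x' := sub_eq_zero.1 (abs_eq_zero.1 (le_antisymm h3 (abs_nonneg _)))
    subst h4
    rfl

/-- Linearizing maps over a neighborhood of the origin in the universal cover descend to the torus:
small pieces of the cover are isometric to their images, and the lift of `A b` is the image of the lift
of `b` as long as both are small. -/
theorem exists_linearization_of_cover {d l : ℕ} {A : Matrix.GeneralLinearGroup (Fin d) ℤ}
    {f : Torus d → ℝ → ℝ} {b₀ : Torus d} (hb₀ : torusAut A b₀ = b₀) {δ ε C : ℝ} (hδ : 0 < δ)
    (hε : 0 < ε) {H : (Fin d → ℝ) → ℝ → ℝ}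
    (hH : ∀ v, ∀ x ∈ Icc 0 ε, H v x ∈ Icc 0 1 ∧ |H v x - x| ≤ C * x ^ 2)
    (hconj : ∀ v, ‖v‖ ≤ δ → ‖coverMap A v‖ ≤ δ → ∀ x ∈ Icc 0 ε,
      fiberMultiplier f (b₀ + torusProj v) * x ∈ Icc 0 ε →
      f (b₀ + torusProj v) (H v x) =
        H (coverMap A v) (fiberMultiplier f (b₀ + torusProj v) * x))
    (hsurj : ∀ v, ∀ y ∈ Icc 0 (ε / 2), ∃ x ∈ Icc 0 ε, H v x = y)
    (hexp : ∀ v, ∀ x ∈ Icc 0 ε, ∀ y ∈ Icc 0 ε, |x - y| ≤ 2 * |H v x - H v y|)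
    {α₀ : ℝ} (hα₀ : 0 < α₀) (hreg : SmoothFamily (fun v w => ‖v - w‖ ^ α₀) ε l H) :
    ∃ (V : Set (Torus d)) (h : Torus d → ℝ → ℝ), IsOpen V ∧ b₀ ∈ V ∧
      (∀ b ∈ V, h b 0 = 0 ∧ HasDerivWithinAt (h b) 0 (Icc 0 ε) 0) ∧
      MapsTo (fiberShift h) (V ×ˢ Icc 0 ε) (phaseSpace d) ∧
      IsEmbedding ((V ×ˢ Icc 0 ε).domRestrict (fiberShift h)) ∧
      fiberShift h '' (V ×ˢ Icc 0 ε) ∈ 𝓝[phaseSpace d] (b₀, 0) ∧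
      (∀ p ∈ V ×ˢ Icc 0 ε, linearizedMap A f p ∈ V ×ˢ Icc 0 ε →
        skewMap A f (fiberShift h p) = fiberShift h (linearizedMap A f p)) ∧
      (∀ b ∈ V, ContDiffOn ℝ l (h b) (Icc 0 ε)) ∧
      (∀ α : ℝ, SmoothFamily (fun v w => ‖v - w‖ ^ α) ε l H →
        ∀ l' : ℕ, l' ≤ l → ∃ C : ℝ, 0 < C ∧ ∀ b ∈ V, ∀ b' ∈ V,
          cNorm l' (Icc 0 ε) (h b - h b') ≤ ENNReal.ofReal (C * dist b b' ^ α)) := by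
  choose c hc hcn using exists_lift (d := d)
  have hcontT : Filter.Tendsto (fun v => ‖coverMap A v‖) (𝓝 0) (𝓝 0) := by
    have h1 : Continuous (coverMap A) := LinearMap.continuous_of_finiteDimensional _
    simpa using h1.norm.tendsto 0
  obtain ⟨δ₁, hδ₁, hT⟩ := Metric.eventually_nhds_iff.1
    (hcontT.eventually_lt_const (by norm_num : (0 : ℝ) < 1 / 4))
  set δ' := min δ (min δ₁ (1 / 4)) with hδ'
  have hδ'0 : 0 < δ' := lt_min hδ (lt_min hδ₁ (by norm_num))
  have hz : (0 : ℝ) ∈ Icc 0 ε := ⟨le_rfl, hε.le⟩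
  set V := Metric.ball b₀ δ' with hV
  set s : Torus d → (Fin d → ℝ) := fun b => c (b - b₀) with hs
  have hsn : ∀ b ∈ V, ‖s b‖ < δ' := fun b hb => by
    rw [hs, hcn, ← dist_eq_norm]; exact hb
  have hsp : ∀ b, b₀ + torusProj (s b) = b := fun b => by
    rw [hs, hc]; abel
  have hsd : ∀ b ∈ V, ∀ b' ∈ V, ‖s b - s b'‖ = dist b b' := by
    intro b hb b' hb'
    have h1 : ‖s b - s b'‖ ≤ 1 / 2 := by
      have h2 := hsn b hb
      have h3 := hsn b' hb'
      have h4 : δ' ≤ 1 / 4 := (min_le_right _ _).trans (min_le_right _ _)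
      have := norm_sub_le (s b) (s b')
      linarith
    rw [← norm_torusProj h1, torusProj_sub, hs, hc, hc, sub_sub_sub_cancel_right, dist_eq_norm]
  set h : Torus d → ℝ → ℝ := fun b x => H (s b) x - x with hh
  have hshift : fiberShift h = fun p => (p.1, H (s p.1) p.2) := by
    funext p
    simp [fiberShift, hh]
  have hH0 : ∀ v, H v 0 = 0 := fun v => by
    simpa using (hH v 0 hz).2
  obtain ⟨M, hM0, -, hM1, hM2⟩ := hreg.lip
  have hσ0 : ∀ (α : ℝ) (v w : Fin d → ℝ), 0 ≤ ‖v - w‖ ^ α := fun α v w => by positivity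
  refine ⟨V, h, Metric.isOpen_ball, Metric.mem_ball_self hδ'0, fun b hb => ⟨?_, ?_⟩, ?_, ?_, ?_, ?_,
    fun b hb => ?_, fun α hα l' hl' => ?_⟩
  · simp [hh, hH0]
  · refine hasDerivWithinAt_of_quadratic_bound (M := C) fun y hy => ?_
    simpa [hh, hH0] using (hH (s b) y hy).2
  · rintro ⟨b, x⟩ ⟨hb, hx⟩
    rw [hshift]
    exact ⟨mem_univ _, (hH _ x hx).1⟩
  · rw [hshift]
    exact isEmbedding_fiberwise (K := fun b x => H (s b) x) hα₀ (fun b _ => hM1 (s b))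
      (fun b hb b' hb' x hx => by rw [← hsd b hb b' hb']; exact hM2 _ _ x hx)
      (fun b _ => hexp (s b))
  · have h1 : V ×ˢ Iio (ε / 2) ∈ 𝓝 (b₀, (0 : ℝ)) :=
      prod_mem_nhds (Metric.ball_mem_nhds _ hδ'0) (Iio_mem_nhds (by positivity))
    refine Filter.mem_of_superset (inter_mem_nhdsWithin _ h1) ?_
    rintro ⟨b, y⟩ ⟨⟨-, hy⟩, hb, hy2⟩
    obtain ⟨x, hx, hxy⟩ := hsurj (s b) y ⟨hy.1, le_of_lt hy2⟩
    refine ⟨(b, x), ⟨hb, hx⟩, ?_⟩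
    rw [hshift]
    simp [hxy]
  · rintro ⟨b, x⟩ ⟨hb, hx⟩ ⟨hb', hx'⟩
    simp only [linearizedMap] at hb' hx' hb hx
    -- the lift of the image is the image of the lift
    have hTs : coverMap A (s b) = s (torusAut A b) := by
      refine eq_of_torusProj_eq ?_ ?_
      · rw [← torusAut_torusProj]
        have h2 : torusAut A b = b₀ + torusAut A (torusProj (s b)) := by
          conv_lhs => rw [← hsp b, torusAut_add, hb₀]
        have h3 := hsp (torusAut A b)
        rw [h2] at h3 ⊢
        exact (add_left_cancel h3).symm
      · have h2 : ‖coverMap A (s b)‖ < 1 / 4 := hT (by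
          rw [dist_zero_right]
          exact (hsn b hb).trans_le ((min_le_right _ _).trans (min_le_left _ _)))
        have h3 : ‖s (torusAut A b)‖ < 1 / 4 :=
          (hsn _ hb').trans_le ((min_le_right _ _).trans (min_le_right _ _))
        have := norm_sub_le (coverMap A (s b)) (s (torusAut A b))
        linarith
    have h4 := hconj (s b) ((hsn b hb).le.trans (min_le_left _ _))
      (by rw [hTs]; exact (hsn _ hb').le.trans (min_le_left _ _)) x hx (by rwa [hsp])
    rw [hsp, hTs] at h4
    rw [hshift]
    simp only [skewMap, linearizedMap, h4]
  · exact (hreg.contDiffOn hε (s b)).sub contDiff_id.contDiffOn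
  · obtain ⟨C', hC'0, hC'⟩ := (hα.sub (SmoothFamily.id (hσ0 α))).exists_cNorm_le hε (hσ0 α)
    refine ⟨C', hC'0, fun b hb b' hb' => ?_⟩
    rw [← hsd b hb b' hb']
    exact hC' l' hl' (s b) (s b')

end Descent

theorem coverMap_inv_coverMap {d : ℕ} (A : Matrix.GeneralLinearGroup (Fin d) ℤ) (v : Fin d → ℝ) :
    coverMap A⁻¹ (coverMap A v) = v := by
  simp only [coverMap, Matrix.mulVecLin_apply, Matrix.mulVec_mulVec]
  have h1 : (A⁻¹).val * A.val = 1 := by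
    rw [← Units.val_mul, inv_mul_cancel, Units.val_one]
  have h2 : (A⁻¹).val.map (fun n : ℤ => (n : ℝ)) * A.val.map (fun n : ℤ => (n : ℝ)) =
      ((A⁻¹).val * A.val).map (fun n : ℤ => (n : ℝ)) :=
    (Matrix.map_mul (f := Int.castRingHom ℝ)).symm
  rw [h2, h1, Matrix.map_one _ (by simp) (by simp), Matrix.one_mulVec]

/-- The linearizing maps over the universal cover, for the map (`λ_{b₀} < 1`) or through its inverse
(`λ_{b₀} > 1`). -/
theorem exists_cover_linearization {d k : ℕ} (hk : 2 ≤ k)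
    (A : Matrix.GeneralLinearGroup (Fin d) ℤ)
    {f : Torus d → ℝ → ℝ} (hf : ∀ b, IsFiberDiffeo k (f b)) {β : ℝ} (hβ : 0 < β)
    (hHolder : ∃ C : ℝ, 0 < C ∧ ∀ b b' : Torus d,
      cNorm k fiberI (f b - f b') ≤ ENNReal.ofReal (C * dist b b' ^ β))
    {b₀ : Torus d} (hne : fiberMultiplier f b₀ ≠ 1)
    {q : ℝ} (hq : contractionRate f b₀ < q) (hq1 : q < 1) :
    ∃ (δ ε C : ℝ) (H : (Fin d → ℝ) → ℝ → ℝ), 0 < δ ∧ 0 < ε ∧ ε ≤ 1 ∧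
      (∀ v, ∀ x ∈ Icc 0 ε, H v x ∈ Icc 0 1 ∧ |H v x - x| ≤ C * x ^ 2) ∧
      (∀ v, ‖v‖ ≤ δ → ‖coverMap A v‖ ≤ δ → ∀ x ∈ Icc 0 ε,
        fiberMultiplier f (b₀ + torusProj v) * x ∈ Icc 0 ε →
        f (b₀ + torusProj v) (H v x) =
          H (coverMap A v) (fiberMultiplier f (b₀ + torusProj v) * x)) ∧
      (∀ v, ∀ y ∈ Icc 0 (ε / 2), ∃ x ∈ Icc 0 ε, H v x = y) ∧
      (∀ v, ∀ x ∈ Icc 0 ε, ∀ y ∈ Icc 0 ε, |x - y| ≤ 2 * |H v x - H v y|) ∧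
      ∀ α, 0 < α → α ≤ β → q * baseExpansion A f b₀ ^ α < 1 →
        SmoothFamily (fun v w => ‖v - w‖ ^ α) ε (k - 2) H := by
  have hpos : 0 < fiberMultiplier f b₀ := (hf b₀).deriv_pos 0 ⟨le_rfl, zero_le_one⟩
  have hq0 : 0 < q := lt_of_le_of_lt (le_min hpos.le (inv_pos.2 hpos).le) hq
  set μ₀ := fiberMultiplier f b₀ with hμ₀
  rcases lt_or_gt_of_ne hne with hlt | hgt
  · have hμq : μ₀ < q := by
      have h1 : μ₀ ≤ μ₀⁻¹ := hlt.le.trans (one_le_inv_iff₀.2 ⟨hpos, hlt.le⟩)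
      rwa [contractionRate, ← hμ₀, min_eq_left h1] at hq
    obtain ⟨q₀, hq₀1, hq₀2⟩ := exists_between hμq
    obtain ⟨δ, c₁, L, lam, r, hδ, hc₁, hlam, hdata, heq, hreg⟩ := exists_lifted_data hk hf hβ hHolder b₀
      (half_pos hpos) (half_lt_self hpos) hq₀1
    obtain ⟨ε, C, H, hε, hεc, -, hH, hconj, hsurj, hexp, hsm⟩ := exists_linearization (coverMap A) hdata
      (fun v => (hlam v).2) hq₀2 hq1 hq0.le
    refine ⟨δ, ε, C, H, hδ, hε, hεc.trans hc₁, fun v x hx =>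
      ⟨⟨(hH v x hx).1.1, (hH v x hx).1.2.trans hc₁⟩, (hH v x hx).2⟩,
      fun v hv _ x hx _ => ?_, hsurj, hexp, fun α hα hαβ hαq => ?_⟩
    · obtain ⟨h1, h2⟩ := heq v hv
      rw [← h1, h2 _ (hH v x hx).1]
      exact hconj v x hx
    · rw [baseExpansion, if_pos hlt] at hαq
      obtain ⟨σ, κ, K, hK, hκ, hσκ, hσ⟩ := exists_adapted_gauge A hα hαq
      exact (hsm σ κ (k - 2) (hreg α σ hα hαβ fun v w => (hσ v w).1) hσκ hκ).mono_gauge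
        (fun v w => by positivity) fun v w => (hσ v w).2
  · have hμq : μ₀⁻¹ < q := by
      have h1 : μ₀⁻¹ ≤ μ₀ := (inv_le_one_of_one_le₀ hgt.le).trans hgt.le
      rwa [contractionRate, ← hμ₀, min_eq_right h1] at hq
    obtain ⟨q₀, hq₀1, hq₀2⟩ := exists_between hμq
    have hq₀0 : 0 < q₀ := (inv_pos.2 hpos).trans hq₀1
    obtain ⟨δ, c₁, L, lam, r, hδ, hc₁, hlam, hdata, heq, hreg⟩ := exists_lifted_data hk hf hβ hHolder b₀
      (inv_pos.2 hq₀0) (inv_lt_of_inv_lt₀ hpos hq₀1) (lt_add_one μ₀)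
    obtain ⟨a', L', g, ha', hdata', hg, hreg'⟩ := exists_inverse_fiberData hdata (inv_pos.2 hq₀0)
      (fun v => (hlam v).1) (fun v => (hlam v).2)
    obtain ⟨ε, C, H, hε, hεa, -, hH, hconj, hsurj, hexp, hsm⟩ := exists_linearization
      (coverMap A⁻¹) (hdata'.comp_base (coverMap A⁻¹))
      (fun v => by
        have := inv_anti₀ (inv_pos.2 hq₀0) (hlam (coverMap A⁻¹ v)).1
        rwa [inv_inv] at this) hq₀2 hq1 hq0.le
    refine ⟨δ, ε, C, H, hδ, hε, hεa.trans (ha'.trans hc₁), fun v x hx =>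
      ⟨⟨(hH v x hx).1.1, (hH v x hx).1.2.trans (ha'.trans hc₁)⟩, (hH v x hx).2⟩,
      fun v hv _ x hx hx' => ?_, hsurj, hexp, fun α hα hαβ hαq => ?_⟩
    · obtain ⟨h1, h2⟩ := heq v hv
      rw [← h1] at hx' ⊢
      have h3 := hconj (coverMap A v) _ hx'
      rw [coverMap_inv_coverMap] at h3
      have hlam0 := (hdata.lam_pos v).ne'
      set y := H (coverMap A v) (lam v * x) with hy
      have hym : y ∈ Icc 0 a' := (hH _ _ hx').1
      obtain ⟨hgm, hgy⟩ := hg v y hym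
      have h4 : (lam v)⁻¹ * (y * Real.exp (-r v (g v y))) = g v y := by
        rw [Real.exp_neg]
        nth_rw 1 [← hgy]
        have := Real.exp_ne_zero (r v (g v y))
        field_simp
      rw [h4, inv_mul_cancel_left₀ hlam0] at h3
      rw [h2 _ ⟨(hH v x hx).1.1, (hH v x hx).1.2.trans ha'⟩, ← h3, hgy]
    · rw [baseExpansion, if_neg hgt.not_gt] at hαq
      obtain ⟨σ, κ, K, hK, hκ, hσκ, hσ⟩ := exists_adapted_gauge A⁻¹ hα hαq
      have hσ0 : ∀ v w, 0 ≤ σ v w := fun v w => le_trans (by positivity) (hσ v w).1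
      exact (hsm σ κ (k - 2) ((hreg' σ (k - 2) (hreg α σ hα hαβ fun v w => (hσ v w).1)).comp_base
        (coverMap A⁻¹) hσ0 hσκ) hσκ hκ).mono_gauge
        (fun v w => by positivity) fun v w => (hσ v w).2

/-! ### Fiberwise linearization near a hyperbolic fixed point -/

theorem theorem1 (d k : ℕ) (hk : 2 ≤ k)
    (A : Matrix.GeneralLinearGroup (Fin d) ℤ) (hA : IsHyperbolicAut A)
    (f : Torus d → ℝ → ℝ) (hf : ∀ b, IsFiberDiffeo k (f b))
    (β : ℝ) (hβ : 0 < β)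
    (hHolder : ∃ C : ℝ, 0 < C ∧ ∀ b b' : Torus d,
      cNorm k fiberI (f b - f b') ≤ ENNReal.ofReal (C * dist b b' ^ β))
    (b₀ : Torus d) (hO : IsHyperbolicFixedPoint A f b₀)
    (q : ℝ) (hq : contractionRate f b₀ < q) (hq1 : q < 1) :
    ∃ (V : Set (Torus d)) (ε : ℝ) (h : Torus d → ℝ → ℝ),
      -- `U = V × [0, ε]` is a neighborhood of `O = (b₀, 0)` in the phase space
      IsOpen V ∧ b₀ ∈ V ∧ 0 < ε ∧ ε ≤ 1 ∧
      -- normalization of `h`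
      (∀ b ∈ V, h b 0 = 0 ∧ HasDerivWithinAt (h b) 0 (Icc 0 ε) 0) ∧
      -- `H` is a homeomorphism of `U` onto a neighborhood of `O` in the phase space
      MapsTo (fiberShift h) (V ×ˢ Icc 0 ε) (phaseSpace d) ∧
      IsEmbedding ((V ×ˢ Icc 0 ε).domRestrict (fiberShift h)) ∧
      fiberShift h '' (V ×ˢ Icc 0 ε) ∈ 𝓝[phaseSpace d] (b₀, 0) ∧
      -- `F ∘ H = H ∘ F₀` wherever both sides make sense
      (∀ p ∈ V ×ˢ Icc 0 ε, linearizedMap A f p ∈ V ×ˢ Icc 0 ε →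
        skewMap A f (fiberShift h p) = fiberShift h (linearizedMap A f p)) ∧
      -- smoothness in the fiber
      (∀ b ∈ V, ContDiffOn ℝ (k - 2 : ℕ) (h b) (Icc 0 ε)) ∧
      -- Hölder dependence on the base point
      (∀ α : ℝ, 0 < α → α < min β (Real.logb (baseExpansion A f b₀) (1 / q)) →
        ∀ l : ℕ, l ≤ k - 2 → ∃ C : ℝ, 0 < C ∧ ∀ b ∈ V, ∀ b' ∈ V,
          cNorm l (Icc 0 ε) (h b - h b') ≤ ENNReal.ofReal (C * dist b b' ^ α)) := by
  have hb₀ : torusAut A b₀ = b₀ := congrArg Prod.fst hO.1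
  have hpos : 0 < fiberMultiplier f b₀ := (hf b₀).deriv_pos 0 ⟨le_rfl, zero_le_one⟩
  have hne : fiberMultiplier f b₀ ≠ 1 := fun h => hO.2.2 (by rw [h, abs_one])
  have hq0 : 0 < q := lt_of_le_of_lt (le_min hpos.le (inv_pos.2 hpos).le) hq
  obtain ⟨δ, ε, C, H, hδ, hε, hε1, hH, hconj, hsurj, hexp, hreg⟩ :=
    exists_cover_linearization hk A hf hβ hHolder hne hq hq1
  have hμ : 0 ≤ baseExpansion A f b₀ := by
    unfold baseExpansion
    split_ifs <;> exact ENNReal.toReal_nonneg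
  -- some exponent is always admissible; it yields the continuity of `H`
  obtain ⟨α₀, hα₀, hα₀β, hα₀q⟩ := exists_exponent hq0 hq1 hμ hβ
  obtain ⟨V, h, hV, hb₀V, hnorm, hmaps, hemb, hnhds, hF, hsmooth, hHol⟩ :=
    exists_linearization_of_cover hb₀ hδ hε hH hconj hsurj hexp hα₀ (hreg α₀ hα₀ hα₀β.le hα₀q)
  refine ⟨V, ε, h, hV, hb₀V, hε, hε1, hnorm, hmaps, hemb, hnhds, hF, hsmooth, fun α hα hαm => ?_⟩
  exact hHol α (hreg α hα (hαm.trans_le (min_le_left _ _)).le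
    (mul_rpow_lt_one_of_lt_logb hq0 hq1 hμ hα (hαm.trans_le (min_le_right _ _))))
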